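/- Let $(\Sigma,g)$ be an oriented smooth Riemannian $3$-manifold and let $\mathcal P\to\Sigma$ be the $\mathrm{SO}(3)$-bundle of oriented orthonormal frames $B=(B_1,B_2,B_3)$. Let $\phi={}^t(\phi^1,\phi^2,\phi^3)$ be the canonical $1$-form on $\mathcal P$, $\phi^i(v)=g(B_i,\pi_*v)$ at $(p,B)$ with $\pi\colon\mathcal P\to\Sigma$ the projection, and let $$\omega=\begin{pmatrix}0&\omega^3&-\omega^2\\-\omega^3&0&\omega^1\\ \omega^2&-\omega^1&0\end{pmatrix}$$ be the Levi-Civita connection form of $g$ on $\mathcal P$, $\omega_{ij}=g(B_i,\nabla B_j)$. Let $$G^{\mathrm F}=2\,(\phi^1\cdot\omega^1+\phi^2\cdot\omega^2+\phi^3\cdot\omega^3)$$ be the Fefferman metric on $\mathcal P$, where $\alpha\cdot\beta=\tfrac12(\alpha\otimes\beta+\beta\otimes\alpha)$, and let $K$ be the vector field on $\mathcal P$ generating the circle action $(p,B)\mapsto(p,B\,e^{sY})$, with $Y=\begin{pmatrix}0&1&0\\-1&0&0\\0&0&0\end{pmatrix}$, which rotates the first two frame vectors. Let $x(t)$, $a\le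 t\le b$ ($a<b$), be a smooth regular curve on $\Sigma$ and let $\gamma(t)=(x(t),B(t))$, $a\le t\le b$, be a smooth curve on $\mathcal P$ which projects to the tangent lift $\tilde x(t)=(x(t),\dot x(t)/|\dot x(t)|)$ in the unit tangent sphere bundle, i.e. $B_3(t)=\dot x(t)/|\dot x(t)|$. Let $\gamma_\epsilon(t)$, $|\epsilon|<\delta$, $a\le t\le b$, be a smooth variation of $\gamma=\gamma_0$ through curves on $\mathcal P$ fixing the endpoints, $\gamma_\epsilon(a)=\gamma(a)$ and $\gamma_\epsilon(b)=\gamma(b)$, such that the variation vector field $(\partial/\partial\epsilon)|_{\epsilon=0}\gamma_\epsilon(t)$ is vertical with respect to $\mathcal P\to\Sigma$ for every $t\in[a,b]$. Then, for all sufficiently small $|\epsilon|$, the function $G^{\mathrm F}(K,\dot\gamma_\epsilon(t))$ has no zero on $[a,b]$ and the integral below is well defined; it is differentiable in $\epsilon$ at $\epsilon=0$, and $$\frac{\mathrm d}{\mathrm d\epsilon}\Big|_{\epsilon=0}\int_a^b\frac{G^{\mathrm F}(\dot\gamma_\epsilon(t),\dot\gamma_\epsilon(t))}{G^{\mathrm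 F}(K,\dot\gamma_\epsilon(t))}\,\mathrm dt=0.$$ -/

import Mathlib

open Set Filter Topology Bundle MeasureTheory
open scoped Manifold ContDiff

noncomputable section

namespace FeffermanFrame

/-- The coordinate space `ℝ³`. -/
abbrev R3 : Type := Fin 3 → ℝ

/-- The standard basis vectors of `ℝ³` (indices `0, 1, 2`). -/
def stdVec (i : Fin 3) : R3 := Pi.single i 1

section Bundles

variable {E : Type*} [NormedAddCommGroup E] [NormedSpace ℝ E]
variable {M : Type*} [TopologicalSpace M] [ChartedSpace E M] [IsManifold 𝓘(ℝ, E) ∞ M]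

variable (E M) in
/-- The total space of the smooth vector bundle `Hom(ℝ³, TM)` over `M`. A point is a pair
`(p, B)` with `B : ℝ³ → T_p M` linear, that is, a triple of tangent vectors
`B e₀, B e₁, B e₂` at `p`. The frame bundle is an embedded submanifold of it. -/
abbrev TripleBundle : Type _ :=
  TotalSpace (R3 →L[ℝ] E)
    (fun p : M => Bundle.Trivial M R3 p →L[ℝ] TangentSpace 𝓘(ℝ, E) p)

variable (E) in
/-- The model with corners of `TripleBundle E M`. -/
abbrev tripleModel : ModelWithCorners ℝ (E × (R3 →L[ℝ] E)) (ModelProd E (R3 →L[ℝ] E)) :=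
  𝓘(ℝ, E).prod 𝓘(ℝ, R3 →L[ℝ] E)

/-- The `i`-th vector of the triple `u = (p, B)`. -/
def frameVec (u : TripleBundle E M) (i : Fin 3) : TangentSpace 𝓘(ℝ, E) u.proj :=
  u.snd (stdVec i)

/-- The triple `u` is a basis of the tangent space which is positively oriented with respect to
the pointwise choice of orientations `o`. -/
def IsPositiveFrame (o : ∀ p : M, Orientation ℝ (TangentSpace 𝓘(ℝ, E) p) (Fin 3))
    (u : TripleBundle E M) : Prop :=
  ∃ b : Module.Basis (Fin 3) ℝ (TangentSpace 𝓘(ℝ, E) u.proj),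
    (∀ i, b i = frameVec u i) ∧ b.orientation = o u.proj

variable (E M) in
/-- An orientation of the 3-manifold `M`: an orientation of every tangent space, depending
continuously on the point, i.e. the positively oriented frames form an open set. -/
structure ManifoldOrientation where
  /-- the orientation of the tangent space at a point -/
  orientationAt : ∀ p : M, Orientation ℝ (TangentSpace 𝓘(ℝ, E) p) (Fin 3)
  isOpen_positive : IsOpen {u : TripleBundle E M | IsPositiveFrame orientationAt u}

variable (E M) in
/-- The smooth Riemannian metrics on `M`. -/
abbrev SmoothMetric : Type _ :=
  ContMDiffRiemannianMetric 𝓘(ℝ, E) ∞ E (fun p : M => TangentSpace 𝓘(ℝ, E) p)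

/-- The bundle `𝒫` of oriented orthonormal frames of `(M, g)`. -/
def frameBundle (g : SmoothMetric E M) (o : ManifoldOrientation E M) : Set (TripleBundle E M) :=
  {u | (∀ i j, g.inner u.proj (frameVec u i) (frameVec u j) = if i = j then 1 else 0) ∧
    IsPositiveFrame o.orientationAt u}

/-- The derivative `π_*` at `u` of the projection `π (p, B) = p`. -/
def projDeriv (u : TripleBundle E M) :
    TangentSpace (tripleModel E) u →L[ℝ] TangentSpace 𝓘(ℝ, E) u.proj :=
  mfderiv (tripleModel E) 𝓘(ℝ, E) (fun w : TripleBundle E M => w.proj) u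

/-- The components `φ⁰, φ¹, φ²` of the canonical 1-form, `φ(v) = B⁻¹ (π_* v)`; at an orthonormal
frame these are the inner products of `π_* v` with the frame vectors. -/
def canonicalForm (g : SmoothMetric E M) (u : TripleBundle E M) (v : TangentSpace (tripleModel E) u)
    (i : Fin 3) : ℝ :=
  g.inner u.proj (frameVec u i) (projDeriv u v)

/-- The metric `g` in the preferred chart at `q`: its value at the point with coordinates `y`
on the coordinate vectors `a`, `b`. -/
def coordMetric (g : SmoothMetric E M) (q : M) (y a b : E) : ℝ :=
  g.inner ((extChartAt 𝓘(ℝ, E) q).symm y)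
    (mfderiv 𝓘(ℝ, E) 𝓘(ℝ, E) (extChartAt 𝓘(ℝ, E) q).symm y a)
    (mfderiv 𝓘(ℝ, E) 𝓘(ℝ, E) (extChartAt 𝓘(ℝ, E) q).symm y b)

/-- The Christoffel symbols of the first kind of `g` in the preferred chart at `q`, as a
trilinear expression: for constant coordinate fields `a`, `b`, `c` this is `g(∇_a b, c)` with `∇`
the Levi-Civita connection,
`(∂_a g(b, c) + ∂_b g(a, c) - ∂_c g(a, b)) / 2`. -/
def christoffel (g : SmoothMetric E M) (q : M) (y a b c : E) : ℝ :=
  (fderiv ℝ (fun z => coordMetric g q z b c) y a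
    + fderiv ℝ (fun z => coordMetric g q z a c) y b
    - fderiv ℝ (fun z => coordMetric g q z a b) y c) / 2

/-- The components in the preferred chart of `TripleBundle E M` at `u` of a tangent vector at
`u`: the first component is the velocity of the base point, the second one the velocity of the
coordinates of the triple. -/
def coordVector (u : TripleBundle E M) (v : TangentSpace (tripleModel E) u) :
    E × (R3 →L[ℝ] E) :=
  mfderiv (tripleModel E) 𝓘(ℝ, E × (R3 →L[ℝ] E)) (extChartAt (tripleModel E) u) u v

/-- The entry `ω_{ij}` of the Levi-Civita connection form `ω = B⁻¹ ∇B`. At an orthonormal frame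
`B = (B₀, B₁, B₂)` it is `ω_{ij}(v) = g(B_i, ∇_v B_j)`, where in coordinates
`∇_v B_j = Ḃ_j + Γ(ẋ, B_j)` for `v = (ẋ, Ḃ)`. On vectors tangent to the orthonormal frame bundle
the matrix is skew-symmetric. -/
def connectionForm (g : SmoothMetric E M) (u : TripleBundle E M) (v : TangentSpace (tripleModel E) u)
    (i j : Fin 3) : ℝ :=
  let y : E := (extChartAt (tripleModel E) u u).1
  let B : R3 →L[ℝ] E := (extChartAt (tripleModel E) u u).2
  let w := coordVector u v
  coordMetric g u.proj y (B (stdVec i)) (w.2 (stdVec j))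
    + christoffel g u.proj y w.1 (B (stdVec j)) (B (stdVec i))

/-- The components `ω¹, ω², ω³` (here indexed by `0, 1, 2`) of the `𝔰𝔬(3)`-valued form `ω`, with
the convention that `ω` is the matrix with rows `(0, ω³, -ω²)`, `(-ω³, 0, ω¹)`, `(ω², -ω¹, 0)`. -/
def connectionComp (g : SmoothMetric E M) (u : TripleBundle E M) (v : TangentSpace (tripleModel E) u) :
    Fin 3 → ℝ :=
  ![connectionForm g u v 1 2, connectionForm g u v 2 0, connectionForm g u v 0 1]

/-- The Fefferman metric `G = 2 (φ¹·ω¹ + φ²·ω² + φ³·ω³)` on the frame bundle, where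
`α·β = (α ⊗ β + β ⊗ α) / 2` is the symmetric product. -/
def feffermanMetric (g : SmoothMetric E M) (u : TripleBundle E M)
    (v w : TangentSpace (tripleModel E) u) : ℝ :=
  ∑ i, (canonicalForm g u v i * connectionComp g u w i
    + canonicalForm g u w i * connectionComp g u v i)

/-- The right action `(p, B) ↦ (p, B A)` of a 3×3 matrix `A`. -/
def rightAct (u : TripleBundle E M) (A : Matrix (Fin 3) (Fin 3) ℝ) : TripleBundle E M :=
  ⟨u.proj, ContinuousLinearMap.comp (M₁ := R3) u.snd
    (LinearMap.toContinuousLinearMap (Matrix.toLin' A))⟩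

/-- The one-parameter group `exp(sY)` in `SO(3)`, where `Y` is the matrix with rows `(0, 1, 0)`,
`(-1, 0, 0)`, `(0, 0, 0)`. -/
def rotation (s : ℝ) : Matrix (Fin 3) (Fin 3) ℝ :=
  !![Real.cos s, Real.sin s, 0; -Real.sin s, Real.cos s, 0; 0, 0, 1]

/-- The flow `s ↦ u · exp(sY)` of the circle action, which rotates the first two frame vectors. -/
def circleFlow (u : TripleBundle E M) (s : ℝ) : TripleBundle E M :=
  rightAct u (rotation s)

theorem circleFlow_zero (u : TripleBundle E M) : circleFlow u 0 = u := by
  have h : rotation 0 = 1 := by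
    ext i j
    fin_cases i <;> fin_cases j <;> simp [rotation]
  rw [circleFlow, h, rightAct, Matrix.toLin'_one]
  rfl

/-- The infinitesimal generator `K` of the circle action on the frame bundle: the velocity at
`s = 0` of the flow (which is at `u` at that time). -/
def circleField (u : TripleBundle E M) : TangentSpace (tripleModel E) u :=
  circleFlow_zero u ▸ mfderiv 𝓘(ℝ, ℝ) (tripleModel E) (circleFlow u) 0 (1 : ℝ)

/-- The velocity at time `t` of a curve in the bundle defined on `[a, b]`. -/
def frameVelocity (a b : ℝ) (γ : ℝ → TripleBundle E M) (t : ℝ) :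
    TangentSpace (tripleModel E) (γ t) :=
  mfderivWithin 𝓘(ℝ, ℝ) (tripleModel E) γ (Icc a b) t (1 : ℝ)

variable (E) in
/-- The velocity at time `t` of a curve in `M` defined on `[a, b]`. -/
def baseVelocity (a b : ℝ) (x : ℝ → M) (t : ℝ) : TangentSpace 𝓘(ℝ, E) (x t) :=
  mfderivWithin 𝓘(ℝ, ℝ) 𝓘(ℝ, E) x (Icc a b) t (1 : ℝ)

variable (E) in
/-- A regular curve `x(t)`, `a ≤ t ≤ b`: smooth with nowhere vanishing velocity. -/
def IsRegularCurve (a b : ℝ) (x : ℝ → M) : Prop :=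
  ContMDiffOn 𝓘(ℝ, ℝ) 𝓘(ℝ, E) ∞ x (Icc a b) ∧ ∀ t ∈ Icc a b, baseVelocity E a b x t ≠ 0

/-- The tangent lift `(x(t), ẋ(t) / |ẋ(t)|)` of a curve to the unit tangent sphere bundle. -/
def tangentLift (g : SmoothMetric E M) (a b : ℝ) (x : ℝ → M) (t : ℝ) : TangentBundle 𝓘(ℝ, E) M :=
  ⟨x t, (√(g.inner (x t) (baseVelocity E a b x t) (baseVelocity E a b x t)))⁻¹ •
    baseVelocity E a b x t⟩

/-- The projection of the frame bundle to the unit tangent sphere bundle: the third vector of the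
frame. -/
def sphereProj (u : TripleBundle E M) : TangentBundle 𝓘(ℝ, E) M :=
  ⟨u.proj, frameVec u 2⟩

/-- `Γ ε t`, for `|ε| < δ` and `a ≤ t ≤ b`, is a smooth variation of `γ` through curves in the
frame bundle, fixing the endpoints. -/
structure IsVariation (g : SmoothMetric E M) (o : ManifoldOrientation E M) (a b δ : ℝ)
    (γ : ℝ → TripleBundle E M) (Γ : ℝ → ℝ → TripleBundle E M) : Prop where
  smooth : ContMDiffOn 𝓘(ℝ, ℝ × ℝ) (tripleModel E) ∞ (fun q : ℝ × ℝ => Γ q.1 q.2)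
    (Ioo (-δ) δ ×ˢ Icc a b)
  mem : ∀ ε ∈ Ioo (-δ) δ, ∀ t ∈ Icc a b, Γ ε t ∈ frameBundle g o
  zero : ∀ t ∈ Icc a b, Γ 0 t = γ t
  left : ∀ ε ∈ Ioo (-δ) δ, Γ ε a = γ a
  right : ∀ ε ∈ Ioo (-δ) δ, Γ ε b = γ b

/-- The variation vector field `∂_ε Γ` at `ε = 0`. -/
def variationField (Γ : ℝ → ℝ → TripleBundle E M) (t : ℝ) : TangentSpace (tripleModel E) (Γ 0 t) :=
  mfderiv 𝓘(ℝ, ℝ) (tripleModel E) (fun ε => Γ ε t) 0 (1 : ℝ)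

/-- The denominator `G(K, γ̇(t))`. -/
def kropinaDenom (g : SmoothMetric E M) (a b : ℝ) (γ : ℝ → TripleBundle E M) (t : ℝ) : ℝ :=
  feffermanMetric g (γ t) (circleField (γ t)) (frameVelocity a b γ t)

/-- The Kropina integrand `G(γ̇(t), γ̇(t)) / G(K, γ̇(t))`. -/
def kropinaIntegrand (g : SmoothMetric E M) (a b : ℝ) (γ : ℝ → TripleBundle E M) (t : ℝ) : ℝ :=
  feffermanMetric g (γ t) (frameVelocity a b γ t) (frameVelocity a b γ t) /
    kropinaDenom g a b γ t

end Bundles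

end FeffermanFrame

end

/-!
With indices in `{0, 1, 2}`, on orthonormal frames `G(K, ·) = φ₂`, so the Kropina integrand is
`2 (φ₀ ω₁₂ + φ₁ ω₂₀) / φ₂ + 2 ω₀₁`. Along the tangent lift `φ(∂ₜ) = (0, 0, f)` with `f ≠ 0`. For a
vertical variation write `V = ω(∂_ε)` and `W = ω(∂ₜ)`. The first structure equation gives
`∂_ε φᵢ(∂ₜ) = f V₂ᵢ`; the second one gives `∂_ε Wᵢⱼ = ∂ₜ Vᵢⱼ + ∑ₖ (Vₖᵢ Wₖⱼ - Vₖⱼ Wₖᵢ)`, without a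
curvature term because `∂_ε` is vertical. As `V` and `W` are skew, everything cancels in the
derivative of the integrand except the total derivative `2 ∂ₜ V₀₁`, whose integral consists of
boundary terms that vanish when the endpoints are fixed.
-/

noncomputable section

namespace FeffermanFrame

/- Shortcuts for instances on bilinear forms that are slow to find. -/
local instance {E F : Type*} [NormedAddCommGroup E] [NormedSpace ℝ E] [NormedAddCommGroup F]
    [NormedSpace ℝ F] : NormedAddCommGroup (E →L[ℝ] F →L[ℝ] ℝ) :=
  ContinuousLinearMap.toNormedAddCommGroup

local instance {E F : Type*} [NormedAddCommGroup E] [NormedSpace ℝ E] [NormedAddCommGroup F]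
    [NormedSpace ℝ F] : NormedSpace ℝ (E →L[ℝ] F →L[ℝ] ℝ) :=
  ContinuousLinearMap.toNormedSpace

section BilinearForms

variable {E : Type*} [NormedAddCommGroup E] [NormedSpace ℝ E]
  {E' : Type*} [NormedAddCommGroup E'] [NormedSpace ℝ E']
  {V : Type*} [NormedAddCommGroup V] [NormedSpace ℝ V]

theorem fderiv_bilin_apply {H : E → V →L[ℝ] E' →L[ℝ] ℝ} {y : E} (hH : DifferentiableAt ℝ H y)
    (v : E) (b : V) (c : E') : fderiv ℝ H y v b c = fderiv ℝ (fun z => H z b c) y v := by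
  rw [((hH.hasFDerivAt.clm_apply (hasFDerivAt_const b y)).clm_apply (hasFDerivAt_const c y)).fderiv]
  simp

theorem fderiv_bilin_symm {H : E → V →L[ℝ] V →L[ℝ] ℝ} {y : E} (hH : DifferentiableAt ℝ H y)
    (hsymm : ∀ z b c, H z b c = H z c b) (v : E) (b c : V) :
    fderiv ℝ H y v b c = fderiv ℝ H y v c b := by
  simp only [fderiv_bilin_apply hH, hsymm _ b c]

theorem fderiv_bilin_pullback {H : E → E →L[ℝ] E →L[ℝ] ℝ} {H' : E' → E' →L[ℝ] E' →L[ℝ] ℝ}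
    {τ : E → E'} {y : E} (hτ : ContDiffAt ℝ 2 τ y) (hH : DifferentiableAt ℝ H y)
    (hH' : DifferentiableAt ℝ H' (τ y))
    (heq : ∀ᶠ z in 𝓝 y, ∀ b c, H z b c = H' (τ z) (fderiv ℝ τ z b) (fderiv ℝ τ z c)) (v b c : E) :
    fderiv ℝ H y v b c =
      fderiv ℝ H' (τ y) (fderiv ℝ τ y v) (fderiv ℝ τ y b) (fderiv ℝ τ y c)
      + H' (τ y) (fderiv ℝ (fderiv ℝ τ) y v b) (fderiv ℝ τ y c)
      + H' (τ y) (fderiv ℝ τ y b) (fderiv ℝ (fderiv ℝ τ) y v c) := by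
  have hτ₁ : HasFDerivAt τ (fderiv ℝ τ y) y := (hτ.differentiableAt (by simp)).hasFDerivAt
  have hτ₂ : HasFDerivAt (fderiv ℝ τ) (fderiv ℝ (fderiv ℝ τ) y) y :=
    ((hτ.fderiv_right (m := 1) (by norm_num)).differentiableAt (by simp)).hasFDerivAt
  have hpull := ((hH'.hasFDerivAt.comp y hτ₁).clm_apply
    (hτ₂.clm_apply (hasFDerivAt_const b y))).clm_apply (hτ₂.clm_apply (hasFDerivAt_const c y))
  rw [fderiv_bilin_apply hH, EventuallyEq.fderiv_eq (heq.mono fun z hz => hz b c)]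
  refine (DFunLike.congr_fun hpull.fderiv v).trans ?_
  simp only [Function.comp_apply, add_apply, ContinuousLinearMap.comp_apply,
    ContinuousLinearMap.flip_apply, map_zero, zero_apply, zero_add]
  ring

theorem hasDerivAt_comp_of_stationary {f : E → V} {x : ℝ → E} {s : ℝ}
    (hf : DifferentiableAt ℝ f (x s)) (hx : HasDerivAt x 0 s) :
    HasDerivAt (fun r => f (x r)) 0 s := by
  have h := hf.hasFDerivAt.comp_hasDerivAt s hx
  rwa [map_zero] at h

end BilinearForms

section LeviCivita

variable {E : Type*} [NormedAddCommGroup E] [NormedSpace ℝ E]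
  {E' : Type*} [NormedAddCommGroup E'] [NormedSpace ℝ E']

/-- The Christoffel symbols of the first kind of a field `H` of bilinear forms: the covector
`c ↦ H(∇_a b, c)` for constant vector fields `a`, `b`. -/
def christoffelForm (H : E → E →L[ℝ] E →L[ℝ] ℝ) (y a b : E) : E →L[ℝ] ℝ :=
  (2⁻¹ : ℝ) • (fderiv ℝ H y a b + fderiv ℝ H y b a - ((fderiv ℝ H y).flip a).flip b)

/-- The covariant derivative with its index lowered, `c ↦ H(c, ∇_T B)`, of a vector field along
a curve through `y` with velocity `T`, whose value is `B` and whose coordinates have derivative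
`B'`. -/
def covDerivForm (H : E → E →L[ℝ] E →L[ℝ] ℝ) (y T B B' : E) : E →L[ℝ] ℝ :=
  (H y).flip B' + christoffelForm H y T B

variable {H : E → E →L[ℝ] E →L[ℝ] ℝ} {y : E}

theorem christoffelForm_apply (a b c : E) :
    christoffelForm H y a b c =
      (fderiv ℝ H y a b c + fderiv ℝ H y b a c - fderiv ℝ H y c a b) / 2 := by
  simp only [christoffelForm, smul_apply, sub_apply, add_apply, ContinuousLinearMap.flip_apply,
    smul_eq_mul]
  ring

theorem covDerivForm_apply (T B B' c : E) :
    covDerivForm H y T B B' c = H y c B' + christoffelForm H y T B c := rfl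

theorem covDerivForm_zero_velocity (B B' c : E) : covDerivForm H y 0 B B' c = H y c B' := by
  simp [covDerivForm_apply, christoffelForm_apply]

theorem christoffelForm_transition {H' : E' → E' →L[ℝ] E' →L[ℝ] ℝ} {τ : E → E'}
    (hτ : ContDiffAt ℝ 2 τ y) (hH : DifferentiableAt ℝ H y) (hH' : DifferentiableAt ℝ H' (τ y))
    (hsymm : ∀ a b, H' (τ y) a b = H' (τ y) b a)
    (heq : ∀ᶠ z in 𝓝 y, ∀ a b, H z a b = H' (τ z) (fderiv ℝ τ z a) (fderiv ℝ τ z b))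
    (a b c : E) :
    christoffelForm H y a b c =
      christoffelForm H' (τ y) (fderiv ℝ τ y a) (fderiv ℝ τ y b) (fderiv ℝ τ y c)
      + H' (τ y) (fderiv ℝ τ y c) (fderiv ℝ (fderiv ℝ τ) y a b) := by
  have hsymm₂ : ∀ v w, fderiv ℝ (fderiv ℝ τ) y v w = fderiv ℝ (fderiv ℝ τ) y w v :=
    fun v w => (hτ.isSymmSndFDerivAt (by simp)).eq v w
  simp only [christoffelForm_apply, fderiv_bilin_pullback hτ hH hH' heq]
  rw [hsymm₂ b a, hsymm₂ c a, hsymm₂ c b, hsymm (fderiv ℝ (fderiv ℝ τ) y a b),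
    hsymm (fderiv ℝ τ y b) (fderiv ℝ (fderiv ℝ τ) y a c),
    hsymm (fderiv ℝ τ y a) (fderiv ℝ (fderiv ℝ τ) y b c)]
  ring

theorem christoffelForm_add_swap (hH : DifferentiableAt ℝ H y) (hsymm : ∀ z a b, H z a b = H z b a)
    (T b c : E) : christoffelForm H y T b c + christoffelForm H y T c b = fderiv ℝ H y T b c := by
  simp only [christoffelForm_apply, fderiv_bilin_symm hH hsymm _ c]
  ring

theorem hasDerivAt_bilin_covDerivForm (hsymm : ∀ z a b, H z a b = H z b a) {x B C : ℝ → E}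
    {x' B' C' : E} {t : ℝ} (hH : DifferentiableAt ℝ H (x t)) (hx : HasDerivAt x x' t)
    (hB : HasDerivAt B B' t) (hC : HasDerivAt C C' t) :
    HasDerivAt (fun r => H (x r) (B r) (C r))
      (covDerivForm H (x t) x' (C t) C' (B t) + covDerivForm H (x t) x' (B t) B' (C t)) t := by
  refine (((hH.hasFDerivAt.comp_hasDerivAt t hx).clm_apply hB).clm_apply hC).congr_deriv ?_
  simp only [Function.comp_apply, add_apply, covDerivForm_apply,
    ← christoffelForm_add_swap hH hsymm, hsymm _ (C t) B']
  ring

theorem hasDerivAt_covDerivForm_of_stationary {x T B B₁ C : ℝ → E} {B' B₁' C' : E} {s : ℝ}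
    (hH : ContDiffAt ℝ 2 H (x s)) (hx : HasDerivAt x 0 s) (hT : HasDerivAt T 0 s)
    (hB : HasDerivAt B B' s) (hB₁ : HasDerivAt B₁ B₁' s) (hC : HasDerivAt C C' s) :
    HasDerivAt (fun r => covDerivForm H (x r) (T r) (B r) (B₁ r) (C r))
      (covDerivForm H (x s) (T s) B' B₁' (C s) + covDerivForm H (x s) (T s) (B s) (B₁ s) C') s := by
  have hH₀ := hasDerivAt_comp_of_stationary (hH.differentiableAt (by simp)) hx
  have hH₁ := hasDerivAt_comp_of_stationary
    ((hH.fderiv_right (m := 1) (by norm_num)).differentiableAt (by simp)) hx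
  have trilin : ∀ {X Y Z : ℝ → E} {X' Y' Z' : E}, HasDerivAt X X' s → HasDerivAt Y Y' s →
      HasDerivAt Z Z' s → HasDerivAt (fun r => fderiv ℝ H (x r) (X r) (Y r) (Z r)) _ s :=
    fun hX hY hZ => ((hH₁.clm_apply hX).clm_apply hY).clm_apply hZ
  simp only [covDerivForm_apply, christoffelForm_apply]
  refine (((hH₀.clm_apply hC).clm_apply hB₁).add
    (((trilin hT hB hC).add (trilin hB hT hC)).sub (trilin hC hT hB) |>.div_const 2)).congr_deriv ?_
  simp only [add_apply, zero_apply, map_zero]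
  ring

end LeviCivita

section FrameCoordinates

variable {E : Type*} [NormedAddCommGroup E] [NormedSpace ℝ E]
  {E' : Type*} [NormedAddCommGroup E'] [NormedSpace ℝ E']
  {V : Type*} [NormedAddCommGroup V] [NormedSpace ℝ V]

/-- The canonical form of the bundle `Hom(V, TM)` in coordinates, for the metric `H`: at
`z = (y, B)` the components of the base velocity along the vectors `B a`. -/
def coordCanonicalForm (H : E → E →L[ℝ] E →L[ℝ] ℝ) (z v : E × (V →L[ℝ] E)) (a : V) : ℝ :=
  H z.1 (z.2 a) v.1

/-- The Levi-Civita connection form `g(B a, ∇_v (B b))` of the bundle `Hom(V, TM)` in coordinates,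
for the metric `H`, at `z = (y, B)`. -/
def coordConnectionForm (H : E → E →L[ℝ] E →L[ℝ] ℝ) (z v : E × (V →L[ℝ] E)) (a b : V) : ℝ :=
  covDerivForm H z.1 v.1 (z.2 b) (v.2 b) (z.2 a)

/-- The change of coordinates on the bundle `Hom(V, TM)` induced by the change `τ` of coordinates
on the base. -/
def framePush (τ : E → E') (z : E × (V →L[ℝ] E)) : E' × (V →L[ℝ] E') :=
  (τ z.1, (fderiv ℝ τ z.1).comp z.2)

theorem hasFDerivAt_framePush {τ : E → E'} {z : E × (V →L[ℝ] E)} (hτ : ContDiffAt ℝ 2 τ z.1) :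
    ∃ L : E × (V →L[ℝ] E) →L[ℝ] E' × (V →L[ℝ] E'), HasFDerivAt (framePush τ) L z ∧
      ∀ v, L v = (fderiv ℝ τ z.1 v.1,
        (fderiv ℝ τ z.1).comp v.2 + (fderiv ℝ (fderiv ℝ τ) z.1 v.1).comp z.2) := by
  have hτ₁ : HasFDerivAt τ (fderiv ℝ τ z.1) z.1 := (hτ.differentiableAt (by simp)).hasFDerivAt
  have hτ₂ : HasFDerivAt (fderiv ℝ τ) (fderiv ℝ (fderiv ℝ τ) z.1) z.1 :=
    ((hτ.fderiv_right (m := 1) (by norm_num)).differentiableAt (by simp)).hasFDerivAt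
  exact ⟨_, (hτ₁.comp z hasFDerivAt_fst).prodMk
    ((hτ₂.comp z hasFDerivAt_fst).clm_comp hasFDerivAt_snd), fun v => rfl⟩

theorem differentiableAt_framePush {τ : E → E'} {z : E × (V →L[ℝ] E)}
    (hτ : ContDiffAt ℝ 2 τ z.1) : DifferentiableAt ℝ (framePush τ) z :=
  let ⟨_, h, _⟩ := hasFDerivAt_framePush hτ
  h.differentiableAt

theorem fderiv_framePush_apply {τ : E → E'} {z : E × (V →L[ℝ] E)} (hτ : ContDiffAt ℝ 2 τ z.1)
    (v : E × (V →L[ℝ] E)) :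
    fderiv ℝ (framePush τ) z v =
      (fderiv ℝ τ z.1 v.1,
        (fderiv ℝ τ z.1).comp v.2 + (fderiv ℝ (fderiv ℝ τ) z.1 v.1).comp z.2) := by
  obtain ⟨L, h, hL⟩ := hasFDerivAt_framePush hτ
  rw [h.fderiv, hL]

theorem coordConnectionForm_framePush {H : E → E →L[ℝ] E →L[ℝ] ℝ}
    {H' : E' → E' →L[ℝ] E' →L[ℝ] ℝ} {τ : E → E'} {z : E × (V →L[ℝ] E)}
    (hτ : ContDiffAt ℝ 2 τ z.1) (hH : DifferentiableAt ℝ H z.1)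
    (hH' : DifferentiableAt ℝ H' (τ z.1)) (hsymm : ∀ a b, H' (τ z.1) a b = H' (τ z.1) b a)
    (heq : ∀ᶠ y in 𝓝 z.1, ∀ a b, H y a b = H' (τ y) (fderiv ℝ τ y a) (fderiv ℝ τ y b))
    (v : E × (V →L[ℝ] E)) (a b : V) :
    coordConnectionForm H' (framePush τ z) (fderiv ℝ (framePush τ) z v) a b =
      coordConnectionForm H z v a b := by
  simp only [coordConnectionForm, fderiv_framePush_apply hτ, framePush, covDerivForm_apply,
    christoffelForm_transition hτ hH hH' hsymm heq, heq.self_of_nhds, add_apply, map_add,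
    ContinuousLinearMap.comp_apply]
  ring

theorem coordConnectionForm_vertical (H : E → E →L[ℝ] E →L[ℝ] ℝ) {z v : E × (V →L[ℝ] E)}
    (hv : v.1 = 0) (a b : V) : coordConnectionForm H z v a b = H z.1 (z.2 a) (v.2 b) := by
  rw [coordConnectionForm, hv, covDerivForm_zero_velocity]

end FrameCoordinates

section Surfaces

variable {F : Type*} [NormedAddCommGroup F] [NormedSpace ℝ F] {f : ℝ × ℝ → F} {s t : ℝ}

theorem hasDerivAt_partial_fst (hf : DifferentiableAt ℝ f (s, t)) :
    HasDerivAt (fun r => f (r, t)) (fderiv ℝ f (s, t) (1, 0)) s :=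
  hf.hasFDerivAt.comp_hasDerivAt (f := fun r => (r, t)) s
    ((hasDerivAt_id s).prodMk (hasDerivAt_const s t))

theorem hasDerivAt_partial_snd (hf : DifferentiableAt ℝ f (s, t)) :
    HasDerivAt (fun r => f (s, r)) (fderiv ℝ f (s, t) (0, 1)) t :=
  hf.hasFDerivAt.comp_hasDerivAt (f := fun r => (s, r)) t
    ((hasDerivAt_const t s).prodMk (hasDerivAt_id t))

theorem hasDerivAt_partial_fst_partial_snd (hf : ContDiffAt ℝ 2 f (s, t)) :
    HasDerivAt (fun r => fderiv ℝ f (r, t) (0, 1))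
      (fderiv ℝ (fderiv ℝ f) (s, t) (1, 0) (0, 1)) s := by
  have hf' := (hf.fderiv_right (m := 1) (by norm_num)).differentiableAt (by simp)
  simpa using (hasDerivAt_partial_fst hf').clm_apply (hasDerivAt_const s ((0 : ℝ), (1 : ℝ)))

theorem hasDerivAt_partial_snd_partial_fst (hf : ContDiffAt ℝ 2 f (s, t)) :
    HasDerivAt (fun r => fderiv ℝ f (s, r) (1, 0))
      (fderiv ℝ (fderiv ℝ f) (s, t) (1, 0) (0, 1)) t := by
  have hf' := (hf.fderiv_right (m := 1) (by norm_num)).differentiableAt (by simp)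
  rw [(hf.isSymmSndFDerivAt (by simp)).eq]
  simpa using (hasDerivAt_partial_snd hf').clm_apply (hasDerivAt_const t ((1 : ℝ), (0 : ℝ)))

end Surfaces

section Orthonormal

variable {E : Type*} [NormedAddCommGroup E] [NormedSpace ℝ E] {ι : Type*} [DecidableEq ι]

/-- The family `C` of vectors is orthonormal for the bilinear form `h`. -/
def IsOrthonormalFor (h : E →L[ℝ] E →L[ℝ] ℝ) (C : ι → E) : Prop :=
  ∀ i j, h (C i) (C j) = if i = j then 1 else 0

theorem IsOrthonormalFor.sum_smul_eq [Fintype ι] [Nonempty ι] {h : E →L[ℝ] E →L[ℝ] ℝ} {C : ι → E}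
    (hC : IsOrthonormalFor h C) (hE : Module.finrank ℝ E = Fintype.card ι) (w : E) :
    ∑ k, h (C k) w • C k = w := by
  have hli : LinearIndependent ℝ C := by
    rw [Fintype.linearIndependent_iff]
    intro c hc i
    simpa [map_sum, hC i _] using congrArg (h (C i)) hc
  have hw : w ∈ Submodule.span ℝ (range C) := by
    rw [hli.span_eq_top_of_card_eq_finrank hE.symm]
    trivial
  obtain ⟨c, rfl⟩ := (Submodule.mem_span_range_iff_exists_fun ℝ).1 hw
  simp [map_sum, hC _ _]

end Orthonormal

section StructureEquations

variable {E : Type*} [NormedAddCommGroup E] [NormedSpace ℝ E]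
  {V : Type*} [NormedAddCommGroup V] [NormedSpace ℝ V] {ι : Type*} [DecidableEq ι] {e : ι → V}
  {H : E → E →L[ℝ] E →L[ℝ] ℝ} {Ψ : ℝ × ℝ → E × (V →L[ℝ] E)} {s t : ℝ}

theorem hasDerivAt_fst_of_prod {ζ : ℝ → E × (V →L[ℝ] E)} {ζ' : E × (V →L[ℝ] E)}
    (hζ : HasDerivAt ζ ζ' t) : HasDerivAt (fun r => (ζ r).1) ζ'.1 t :=
  (ContinuousLinearMap.fst ℝ E (V →L[ℝ] E)).hasFDerivAt.comp_hasDerivAt t hζ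

theorem hasDerivAt_snd_apply {ζ : ℝ → E × (V →L[ℝ] E)} {ζ' : E × (V →L[ℝ] E)}
    (hζ : HasDerivAt ζ ζ' t) (a : V) : HasDerivAt (fun r => (ζ r).2 a) (ζ'.2 a) t :=
  (((ContinuousLinearMap.apply ℝ E a).comp
    (ContinuousLinearMap.snd ℝ E (V →L[ℝ] E))).hasFDerivAt).comp_hasDerivAt t hζ

theorem coordConnectionForm_skew (hsymm : ∀ z a b, H z a b = H z b a)
    {ζ : ℝ → E × (V →L[ℝ] E)} {ζ' : E × (V →L[ℝ] E)} (hH : DifferentiableAt ℝ H (ζ t).1)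
    (hζ : HasDerivAt ζ ζ' t)
    (hon : ∀ᶠ r in 𝓝 t, IsOrthonormalFor (H (ζ r).1) fun i => (ζ r).2 (e i)) (i j : ι) :
    coordConnectionForm H (ζ t) ζ' (e i) (e j) = -coordConnectionForm H (ζ t) ζ' (e j) (e i) := by
  have hconst := (hasDerivAt_const t (if i = j then (1 : ℝ) else 0)).congr_of_eventuallyEq
    (hon.mono fun r hr => hr i j)
  exact eq_neg_of_add_eq_zero_left
    ((hasDerivAt_bilin_covDerivForm hsymm hH (hasDerivAt_fst_of_prod hζ)
      (hasDerivAt_snd_apply hζ _) (hasDerivAt_snd_apply hζ _)).unique hconst)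

theorem fst_mixed_partial_eq_zero_of_vertical (hΨ : ContDiffAt ℝ 2 Ψ (s, t))
    (hvert : ∀ᶠ r in 𝓝 t, (fderiv ℝ Ψ (s, r) (1, 0)).1 = 0) :
    (fderiv ℝ (fderiv ℝ Ψ) (s, t) (1, 0) (0, 1)).1 = 0 :=
  (hasDerivAt_fst_of_prod (hasDerivAt_partial_snd_partial_fst hΨ)).unique
    ((hasDerivAt_const t (0 : E)).congr_of_eventuallyEq hvert)

theorem hasDerivAt_coordCanonicalForm_of_vertical (hsymm : ∀ z a b, H z a b = H z b a)
    (hH : DifferentiableAt ℝ H (Ψ (s, t)).1) (hΨ : ContDiffAt ℝ 2 Ψ (s, t))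
    (hvert : ∀ᶠ r in 𝓝 t, (fderiv ℝ Ψ (s, r) (1, 0)).1 = 0) {f : ℝ} {b : V}
    (hlift : (fderiv ℝ Ψ (s, t) (0, 1)).1 = f • (Ψ (s, t)).2 b) (a : V) :
    HasDerivAt (fun ε => coordCanonicalForm H (Ψ (ε, t)) (fderiv ℝ Ψ (ε, t) (0, 1)) a)
      (f * coordConnectionForm H (Ψ (s, t)) (fderiv ℝ Ψ (s, t) (1, 0)) b a) s := by
  have hε := hasDerivAt_partial_fst (hΨ.differentiableAt (by simp))
  have hx : HasDerivAt (fun ε => (Ψ (ε, t)).1) 0 s := hvert.self_of_nhds ▸ hasDerivAt_fst_of_prod hε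
  have hT := hasDerivAt_fst_of_prod (hasDerivAt_partial_fst_partial_snd hΨ)
  refine (((hasDerivAt_comp_of_stationary hH hx).clm_apply
    (hasDerivAt_snd_apply hε a)).clm_apply hT).congr_deriv ?_
  rw [fst_mixed_partial_eq_zero_of_vertical hΨ hvert, hlift,
    coordConnectionForm_vertical H hvert.self_of_nhds]
  simp [hsymm _ ((Ψ (s, t)).2 b)]

theorem exists_hasDerivAt_coordConnectionForm_of_vertical (hsymm : ∀ z a b, H z a b = H z b a)
    (hH : ContDiffAt ℝ 2 H (Ψ (s, t)).1) (hΨ : ContDiffAt ℝ 2 Ψ (s, t))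
    (hvert : ∀ᶠ r in 𝓝 t, (fderiv ℝ Ψ (s, r) (1, 0)).1 = 0) (a b : V) :
    ∃ c, HasDerivAt
        (fun r => coordConnectionForm H (Ψ (s, r)) (fderiv ℝ Ψ (s, r) (1, 0)) a b) c t ∧
      HasDerivAt (fun ε => coordConnectionForm H (Ψ (ε, t)) (fderiv ℝ Ψ (ε, t) (0, 1)) a b)
        (c + covDerivForm H (Ψ (s, t)).1 (fderiv ℝ Ψ (s, t) (0, 1)).1 ((Ψ (s, t)).2 b)
            ((fderiv ℝ Ψ (s, t) (0, 1)).2 b) ((fderiv ℝ Ψ (s, t) (1, 0)).2 a)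
          - covDerivForm H (Ψ (s, t)).1 (fderiv ℝ Ψ (s, t) (0, 1)).1 ((Ψ (s, t)).2 a)
            ((fderiv ℝ Ψ (s, t) (0, 1)).2 a) ((fderiv ℝ Ψ (s, t) (1, 0)).2 b)) s := by
  have hε := hasDerivAt_partial_fst (hΨ.differentiableAt (by simp))
  have ht := hasDerivAt_partial_snd (hΨ.differentiableAt (by simp))
  have hεt := hasDerivAt_partial_fst_partial_snd hΨ
  have htε := hasDerivAt_partial_snd_partial_fst hΨ
  have hx : HasDerivAt (fun ε => (Ψ (ε, t)).1) 0 s := hvert.self_of_nhds ▸ hasDerivAt_fst_of_prod hε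
  have hT : HasDerivAt (fun ε => (fderiv ℝ Ψ (ε, t) (0, 1)).1) 0 s :=
    fst_mixed_partial_eq_zero_of_vertical hΨ hvert ▸ hasDerivAt_fst_of_prod hεt
  refine ⟨_, (hasDerivAt_bilin_covDerivForm hsymm (hH.differentiableAt (by simp))
    (hasDerivAt_fst_of_prod ht) (hasDerivAt_snd_apply ht a)
    (hasDerivAt_snd_apply htε b)).congr_of_eventuallyEq
      (hvert.mono fun r hr => coordConnectionForm_vertical H hr a b), ?_⟩
  refine (hasDerivAt_covDerivForm_of_stationary hH hx hT (hasDerivAt_snd_apply hε b)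
    (hasDerivAt_snd_apply hεt b) (hasDerivAt_snd_apply hε a)).congr_deriv ?_
  ring

theorem sum_coordConnectionForm_mul [Fintype ι] [Nonempty ι]
    (hE : Module.finrank ℝ E = Fintype.card ι) {z v w : E × (V →L[ℝ] E)}
    (hz : IsOrthonormalFor (H z.1) fun i => z.2 (e i)) (hv : v.1 = 0) (i j : ι) :
    ∑ k, coordConnectionForm H z v (e k) (e i) * coordConnectionForm H z w (e k) (e j) =
      covDerivForm H z.1 w.1 (z.2 (e j)) (w.2 (e j)) (v.2 (e i)) := by
  conv_rhs => rw [← hz.sum_smul_eq hE (v.2 (e i)), map_sum]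
  simp only [map_smul, smul_eq_mul, coordConnectionForm_vertical H hv]
  rfl

theorem exists_hasDerivAt_coordConnectionForm_of_orthonormal [Fintype ι] [Nonempty ι]
    (hE : Module.finrank ℝ E = Fintype.card ι) (hsymm : ∀ z a b, H z a b = H z b a)
    (hH : ContDiffAt ℝ 2 H (Ψ (s, t)).1) (hΨ : ContDiffAt ℝ 2 Ψ (s, t))
    (hvert : ∀ᶠ r in 𝓝 t, (fderiv ℝ Ψ (s, r) (1, 0)).1 = 0)
    (hon : IsOrthonormalFor (H (Ψ (s, t)).1) fun i => (Ψ (s, t)).2 (e i))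
    {v w : ι → ι → ℝ}
    (hv : v = fun i j => coordConnectionForm H (Ψ (s, t)) (fderiv ℝ Ψ (s, t) (1, 0)) (e i) (e j))
    (hw : w = fun i j => coordConnectionForm H (Ψ (s, t)) (fderiv ℝ Ψ (s, t) (0, 1)) (e i) (e j))
    (i j : ι) :
    ∃ c, HasDerivAt (fun r =>
        coordConnectionForm H (Ψ (s, r)) (fderiv ℝ Ψ (s, r) (1, 0)) (e i) (e j)) c t ∧
      HasDerivAt (fun ε =>
        coordConnectionForm H (Ψ (ε, t)) (fderiv ℝ Ψ (ε, t) (0, 1)) (e i) (e j))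
        (c + ∑ k, v k i * w k j - ∑ k, v k j * w k i) s := by
  subst hv hw
  simp only [sum_coordConnectionForm_mul hE hon hvert.self_of_nhds]
  exact exists_hasDerivAt_coordConnectionForm_of_vertical hsymm hH hΨ hvert (e i) (e j)

end StructureEquations

section KropinaQuotient

/-- The Kropina quotient `G(v, v) / G(K, v)` in terms of the values `φ` and `θ` on `v` of the
canonical and the connection form. -/
def kropinaQuotient (φ : Fin 3 → ℝ) (θ : Fin 3 → Fin 3 → ℝ) : ℝ :=
  2 * (φ 0 * θ 1 2 + φ 1 * θ 2 0 + φ 2 * θ 0 1) / φ 2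

theorem hasDerivAt_kropinaQuotient {φ : ℝ → Fin 3 → ℝ} {θ : ℝ → Fin 3 → Fin 3 → ℝ}
    {v : Fin 3 → Fin 3 → ℝ} {f c s : ℝ} (hv : ∀ i j, v i j = -v j i)
    (hθ : ∀ i j, θ s i j = -θ s j i) (hf : f ≠ 0) (hφ : φ s = ![0, 0, f])
    (hφ' : ∀ i, HasDerivAt (fun ε => φ ε i) (f * v 2 i) s)
    (hθ' : ∀ i j, ∃ c, HasDerivAt (fun ε => θ ε i j) c s)
    (hθ01 : HasDerivAt (fun ε => θ ε 0 1)
      (c + ∑ k, v k 0 * θ s k 1 - ∑ k, v k 1 * θ s k 0) s) :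
    HasDerivAt (fun ε => kropinaQuotient (φ ε) (θ ε)) (2 * c) s := by
  obtain ⟨_, hθ12⟩ := hθ' 1 2
  obtain ⟨_, hθ20⟩ := hθ' 2 0
  have hdiag : ∀ {a : Fin 3 → Fin 3 → ℝ}, (∀ i j, a i j = -a j i) → ∀ i, a i i = 0 :=
    fun ha i => by linarith [ha i i]
  have hφ0 : φ s 0 = 0 := by simp [hφ]
  have hφ1 : φ s 1 = 0 := by simp [hφ]
  have hφ2 : φ s 2 = f := by simp [hφ]
  refine (((((hφ' 0).mul hθ12).add ((hφ' 1).mul hθ20)).add ((hφ' 2).mul hθ01)).const_mul 2).div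
    (hφ' 2) (by rwa [hφ2]) |>.congr_deriv ?_
  simp only [Pi.add_apply, Pi.mul_apply, hφ0, hφ1, hφ2, Fin.sum_univ_three, hdiag hv, hdiag hθ,
    hθ 2 1]
  field_simp
  ring

theorem exists_hasDerivAt_kropinaQuotient_coord {E : Type*} [NormedAddCommGroup E]
    [NormedSpace ℝ E] {V : Type*} [NormedAddCommGroup V] [NormedSpace ℝ V] {e : Fin 3 → V}
    {H : E → E →L[ℝ] E →L[ℝ] ℝ} {Ψ : ℝ × ℝ → E × (V →L[ℝ] E)} {s t f : ℝ}
    (hE : Module.finrank ℝ E = 3) (hsymm : ∀ z a b, H z a b = H z b a)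
    (hH : ContDiffAt ℝ 2 H (Ψ (s, t)).1) (hΨ : ContDiffAt ℝ 2 Ψ (s, t))
    (hvert : ∀ᶠ r in 𝓝 t, (fderiv ℝ Ψ (s, r) (1, 0)).1 = 0)
    (hon : ∀ᶠ p in 𝓝 (s, t), IsOrthonormalFor (H (Ψ p).1) fun i => (Ψ p).2 (e i))
    (hf : f ≠ 0) (hlift : (fderiv ℝ Ψ (s, t) (0, 1)).1 = f • (Ψ (s, t)).2 (e 2)) :
    ∃ c, HasDerivAt (fun r =>
        coordConnectionForm H (Ψ (s, r)) (fderiv ℝ Ψ (s, r) (1, 0)) (e 0) (e 1)) c t ∧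
      HasDerivAt (fun ε => kropinaQuotient
          (fun i => coordCanonicalForm H (Ψ (ε, t)) (fderiv ℝ Ψ (ε, t) (0, 1)) (e i))
          (fun i j => coordConnectionForm H (Ψ (ε, t)) (fderiv ℝ Ψ (ε, t) (0, 1)) (e i) (e j)))
        (2 * c) s := by
  have hHd := hH.differentiableAt (by simp)
  have hΨd := hΨ.differentiableAt (by simp)
  have hskew_fst := coordConnectionForm_skew hsymm hHd (hasDerivAt_partial_fst hΨd)
    ((Continuous.prodMk_left t).continuousAt.eventually hon)
  have hskew_snd := coordConnectionForm_skew hsymm hHd (hasDerivAt_partial_snd hΨd)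
    ((Continuous.prodMk_right s).continuousAt.eventually hon)
  have hstructure := exists_hasDerivAt_coordConnectionForm_of_orthonormal (by simpa using hE)
    hsymm hH hΨ hvert hon.self_of_nhds rfl rfl
  obtain ⟨c, hV, hW⟩ := hstructure 0 1
  refine ⟨c, hV, hasDerivAt_kropinaQuotient hskew_fst hskew_snd hf ?_
    (fun i => hasDerivAt_coordCanonicalForm_of_vertical hsymm hHd hΨ hvert hlift (e i))
    (fun i j => (hstructure i j).imp' _ fun _ h => h.2) hW⟩
  ext i
  rw [coordCanonicalForm, hlift, map_smul, hon.self_of_nhds i 2]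
  fin_cases i <;> simp

end KropinaQuotient

section ParametricIntegral

variable {G : Type*} [NormedAddCommGroup G] [NormedSpace ℝ G] {L : ℝ × ℝ → G} {L' v : ℝ → G}
  {s : Set ℝ} {a b ε₀ : ℝ}

theorem ae_mem_uIoc_imp_mem_Ioo (hab : a < b) : ∀ᵐ t : ℝ, t ∈ uIoc a b → t ∈ Ioo a b := by
  filter_upwards [Measure.ae_ne volume b] with t ht htab
  rw [uIoc_of_le hab.le] at htab
  exact ⟨htab.1, lt_of_le_of_ne htab.2 ht⟩

theorem aestronglyMeasurable_of_contDiffOn_of_hasDerivAt (hab : a < b) (hs : s ∈ 𝓝 ε₀)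
    (hsu : UniqueDiffOn ℝ s) (hL : ContDiffOn ℝ 1 L (s ×ˢ Icc a b))
    (hL' : ∀ t ∈ Ioo a b, HasDerivAt (fun ε => L (ε, t)) (L' t) ε₀) :
    AEStronglyMeasurable L' (volume.restrict (uIoc a b)) := by
  have hcont : ContinuousOn (fun t => fderivWithin ℝ L (s ×ˢ Icc a b) (ε₀, t) (1, 0)) (Icc a b) :=
    ((hL.continuousOn_fderivWithin (hsu.prod (uniqueDiffOn_Icc hab)) le_rfl).comp
      (f := fun t => (ε₀, t)) (by fun_prop) fun t ht => ⟨mem_of_mem_nhds hs, ht⟩).clm_apply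
      continuousOn_const
  have hmeas :=
    (hcont.mono Ioc_subset_Icc_self).aestronglyMeasurable (μ := volume) measurableSet_Ioc
  rw [← uIoc_of_le hab.le] at hmeas
  refine hmeas.congr ((ae_restrict_iff' measurableSet_uIoc).2 ?_)
  filter_upwards [ae_mem_uIoc_imp_mem_Ioo hab] with t ht htab
  have hnhds := prod_mem_nhds hs (Icc_mem_nhds (ht htab).1 (ht htab).2)
  rw [fderivWithin_of_mem_nhds hnhds]
  exact (hasDerivAt_partial_fst ((hL.contDiffAt hnhds).differentiableAt (by simp))).unique
    (hL' t (ht htab))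

theorem hasDerivAt_integral_of_contDiffOn (hab : a < b) (hs : s ∈ 𝓝 ε₀)
    (hL : ContDiffOn ℝ 1 L (s ×ˢ Icc a b))
    (hL' : ∀ t ∈ Ioo a b, HasDerivAt (fun ε => L (ε, t)) (L' t) ε₀) :
    IntervalIntegrable L' volume a b ∧
      HasDerivAt (fun ε => ∫ t in a..b, L (ε, t)) (∫ t in a..b, L' t) ε₀ := by
  obtain ⟨η, hη, hηs⟩ := (nhds_basis_Icc_pos ε₀).mem_iff.1 hs
  set J : Set ℝ := Icc (ε₀ - η) (ε₀ + η)
  have hJ : J ∈ 𝓝 ε₀ := Icc_mem_nhds (by linarith) (by linarith)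
  have hJu : UniqueDiffOn ℝ J := uniqueDiffOn_Icc (by linarith)
  replace hL : ContDiffOn ℝ 1 L (J ×ˢ Icc a b) := hL.mono (prod_mono_left hηs)
  obtain ⟨K, hK⟩ := (isCompact_Icc.prod isCompact_Icc).exists_bound_of_continuousOn
    (hL.continuousOn_fderivWithin (hJu.prod (uniqueDiffOn_Icc hab)) le_rfl)
  have hlip : LipschitzOnWith (Real.nnabs K) L (J ×ˢ Icc a b) :=
    ((convex_Icc _ _).prod (convex_Icc _ _)).lipschitzOnWith_of_nnnorm_fderivWithin_le
      (hL.differentiableOn (by simp)) fun p hp =>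
        NNReal.coe_le_coe.1 (by simpa using (hK p hp).trans (le_abs_self K))
  have hint : ∀ ε ∈ J, IntervalIntegrable (fun t => L (ε, t)) volume a b := fun ε hε =>
    ContinuousOn.intervalIntegrable_of_Icc hab.le
      (hL.continuousOn.comp (f := fun t => (ε, t)) (by fun_prop) fun t ht => ⟨hε, ht⟩)
  refine intervalIntegral.hasDerivAt_integral_of_dominated_loc_of_lip
    (bound := fun _ => K) hJ
    (by
      filter_upwards [hJ] with ε hε
      exact (intervalIntegrable_iff.1 (hint ε hε)).aestronglyMeasurable)
    (hint ε₀ (mem_of_mem_nhds hJ))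
    (aestronglyMeasurable_of_contDiffOn_of_hasDerivAt hab hJ hJu hL hL') ?_
    intervalIntegrable_const ?_
  · filter_upwards [ae_mem_uIoc_imp_mem_Ioo hab] with t ht htab
    have ht' := Ioo_subset_Icc_self (ht htab)
    refine LipschitzOnWith.of_dist_le_mul fun x hx z hz => ?_
    simpa [Prod.dist_eq] using hlip.dist_le_mul (x, t) ⟨hx, ht'⟩ (z, t) ⟨hz, ht'⟩
  · filter_upwards [ae_mem_uIoc_imp_mem_Ioo hab] with t ht htab using hL' t (ht htab)

theorem hasDerivAt_integral_of_variation_eq_deriv [CompleteSpace G] (hab : a < b)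
    (hs : s ∈ 𝓝 ε₀) (hL : ContDiffOn ℝ 1 L (s ×ˢ Icc a b)) (hv : ContinuousOn v (Icc a b))
    (hder : ∀ t ∈ Ioo a b, ∃ c, HasDerivAt v c t ∧ HasDerivAt (fun ε => L (ε, t)) c ε₀) :
    HasDerivAt (fun ε => ∫ t in a..b, L (ε, t)) (v b - v a) ε₀ := by
  have hderiv : ∀ t ∈ Ioo a b, HasDerivAt v (deriv v t) t ∧
      HasDerivAt (fun ε => L (ε, t)) (deriv v t) ε₀ := fun t ht => by
    obtain ⟨c, hvc, hLc⟩ := hder t ht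
    exact hvc.deriv ▸ ⟨hvc, hLc⟩
  obtain ⟨hint, hL'⟩ := hasDerivAt_integral_of_contDiffOn hab hs hL fun t ht => (hderiv t ht).2
  rwa [intervalIntegral.integral_eq_sub_of_hasDerivAt_of_le hab.le hv
    (fun t ht => (hderiv t ht).1) hint] at hL'

end ParametricIntegral

section Charts

variable {E : Type*} [NormedAddCommGroup E] [NormedSpace ℝ E]
  {M : Type*} [TopologicalSpace M] [ChartedSpace E M]

variable (E) in
/-- The derivative at `p` of the preferred chart at `q`. -/
def chartDeriv (q p : M) : E →L[ℝ] E := mfderiv 𝓘(ℝ, E) 𝓘(ℝ, E) (extChartAt 𝓘(ℝ, E) q) p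

/-- The derivative at `y` of the inverse of the preferred chart at `q`. -/
def chartSymmDeriv (q : M) (y : E) : E →L[ℝ] E :=
  mfderiv 𝓘(ℝ, E) 𝓘(ℝ, E) (extChartAt 𝓘(ℝ, E) q).symm y

/-- The transition map from the preferred chart at `q` to the one at `q'`. -/
def transition (q q' : M) (y : E) : E := extChartAt 𝓘(ℝ, E) q' ((extChartAt 𝓘(ℝ, E) q).symm y)

theorem eventually_mem_transition {q q' : M} {y : E} (hy : y ∈ (extChartAt 𝓘(ℝ, E) q).target)
    (hy' : (extChartAt 𝓘(ℝ, E) q).symm y ∈ (extChartAt 𝓘(ℝ, E) q').source) :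
    ∀ᶠ z in 𝓝 y, z ∈ (extChartAt 𝓘(ℝ, E) q).target ∧
      (extChartAt 𝓘(ℝ, E) q).symm z ∈ (extChartAt 𝓘(ℝ, E) q').source :=
  ((isOpen_extChartAt_target q).eventually_mem hy).and
    ((continuousAt_extChartAt_symm'' hy).preimage_mem_nhds
      ((isOpen_extChartAt_source q').mem_nhds hy'))

variable [IsManifold 𝓘(ℝ, E) ∞ M]

theorem chartSymmDeriv_chartDeriv {q p : M} (hp : p ∈ (extChartAt 𝓘(ℝ, E) q).source) (v : E) :
    chartSymmDeriv q (extChartAt 𝓘(ℝ, E) q p) (chartDeriv E q p v) = v := by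
  have hcomp := mfderivWithin_extChartAt_symm_comp_mfderiv_extChartAt' (I := 𝓘(ℝ, E)) hp
  rw [modelWithCornersSelf_coe, range_id, mfderivWithin_univ] at hcomp
  exact DFunLike.congr_fun hcomp v

theorem chartDeriv_chartSymmDeriv {q : M} {y : E} (hy : y ∈ (extChartAt 𝓘(ℝ, E) q).target) (v : E) :
    chartDeriv E q ((extChartAt 𝓘(ℝ, E) q).symm y) (chartSymmDeriv q y v) = v := by
  have hcomp := mfderiv_extChartAt_comp_mfderivWithin_extChartAt_symm (I := 𝓘(ℝ, E)) hy
  rw [modelWithCornersSelf_coe, range_id, mfderivWithin_univ] at hcomp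
  exact DFunLike.congr_fun hcomp v

theorem chartSymmDeriv_eq_trivializationAt_symm {q p : M}
    (hp : p ∈ (extChartAt 𝓘(ℝ, E) q).source) (v : E) :
    chartSymmDeriv q (extChartAt 𝓘(ℝ, E) q p) v =
      (trivializationAt E (TangentSpace 𝓘(ℝ, E)) q).symm p v := by
  have hsymm := DFunLike.congr_fun (TangentBundle.symmL_trivializationAt (I := 𝓘(ℝ, E)) (𝕜 := ℝ)
    (x₀ := q) (x := p) (by simpa using hp)) v
  rw [modelWithCornersSelf_coe, range_id, mfderivWithin_univ,
    Trivialization.symmL_apply _ (by simpa using hp)] at hsymm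
  exact hsymm.symm

theorem contDiffAt_transition {q q' : M} {y : E} (hy : y ∈ (extChartAt 𝓘(ℝ, E) q).target)
    (hy' : (extChartAt 𝓘(ℝ, E) q).symm y ∈ (extChartAt 𝓘(ℝ, E) q').source) :
    ContDiffAt ℝ ∞ (transition q q') y := by
  have hsymm := (contMDiffOn_extChartAt_symm (I := 𝓘(ℝ, E)) (n := ∞) q).contMDiffAt
    ((isOpen_extChartAt_target q).mem_nhds hy)
  have hchart := contMDiffAt_extChartAt' (I := 𝓘(ℝ, E)) (n := ∞) (x := q')
    (x' := (extChartAt 𝓘(ℝ, E) q).symm y) (by simpa using hy')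
  exact contMDiffAt_iff_contDiffAt.1 (hchart.comp y hsymm)

theorem chartDeriv_eq_fderiv_transition {q q' p : M} (hp : p ∈ (extChartAt 𝓘(ℝ, E) q).source)
    (hp' : p ∈ (extChartAt 𝓘(ℝ, E) q').source) (v : E) :
    chartDeriv E q' p v =
      fderiv ℝ (transition q q') (extChartAt 𝓘(ℝ, E) q p) (chartDeriv E q p v) := by
  have hτ := (contDiffAt_transition (q' := q') ((extChartAt 𝓘(ℝ, E) q).map_source hp)
    (by rwa [(extChartAt 𝓘(ℝ, E) q).left_inv hp])).differentiableAt (by simp)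
  have hfactor : extChartAt 𝓘(ℝ, E) q' =ᶠ[𝓝 p] transition q q' ∘ extChartAt 𝓘(ℝ, E) q := by
    filter_upwards [(isOpen_extChartAt_source q).mem_nhds hp] with z hz
    rw [Function.comp_apply, transition, (extChartAt 𝓘(ℝ, E) q).left_inv hz]
  have hcomp := mfderiv_comp p (I := 𝓘(ℝ, E)) (I' := 𝓘(ℝ, E)) (I'' := 𝓘(ℝ, E))
    hτ.mdifferentiableAt (mdifferentiableAt_extChartAt (by simpa using hp))
  rw [mfderiv_eq_fderiv] at hcomp
  exact DFunLike.congr_fun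
    ((hfactor.mfderiv_eq (I := 𝓘(ℝ, E)) (I' := 𝓘(ℝ, E))).trans hcomp) v

end Charts

section MetricInCharts

variable {E : Type*} [NormedAddCommGroup E] [NormedSpace ℝ E]
  {M : Type*} [TopologicalSpace M] [ChartedSpace E M] [IsManifold 𝓘(ℝ, E) ∞ M]
  (g : SmoothMetric E M) {q q' p : M} {y : E}

/-- The metric at a point, as a bilinear form on the model space. -/
def innerModel (p : M) : E →L[ℝ] E →L[ℝ] ℝ := g.inner p

/-- The metric in the preferred chart at `q`, as a field of bilinear forms. -/
def metricForm (q : M) (y : E) : E →L[ℝ] E →L[ℝ] ℝ :=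
  (innerModel g ((extChartAt 𝓘(ℝ, E) q).symm y)).bilinearComp (chartSymmDeriv q y)
    (chartSymmDeriv q y)

theorem coordMetric_eq (a b : E) : coordMetric g q y a b = metricForm g q y a b := rfl

theorem metricForm_symm (q : M) (y a b : E) : metricForm g q y a b = metricForm g q y b a := by
  simp only [metricForm, ContinuousLinearMap.bilinearComp_apply]
  exact g.symm _ _ _

theorem metricForm_chartDeriv (hp : p ∈ (extChartAt 𝓘(ℝ, E) q).source) (v w : E) :
    metricForm g q (extChartAt 𝓘(ℝ, E) q p) (chartDeriv E q p v) (chartDeriv E q p w) =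
      innerModel g p v w := by
  simp only [metricForm, ContinuousLinearMap.bilinearComp_apply, chartSymmDeriv_chartDeriv hp,
    (extChartAt 𝓘(ℝ, E) q).left_inv hp]

theorem contDiffAt_metricForm (hy : y ∈ (extChartAt 𝓘(ℝ, E) q).target) :
    ContDiffAt ℝ ∞ (metricForm g q) y := by
  have hsource := (extChartAt 𝓘(ℝ, E) q).map_target hy
  have hsection := ((trivializationAt (E →L[ℝ] E →L[ℝ] ℝ) (fun p : M =>
      TangentSpace 𝓘(ℝ, E) p →L[ℝ] TangentSpace 𝓘(ℝ, E) p →L[ℝ] ℝ) q).contMDiffAt_section_iff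
      (IB := 𝓘(ℝ, E)) (n := ∞) (s := g.inner) (x₀ := (extChartAt 𝓘(ℝ, E) q).symm y)
      (by simpa using hsource)).1 (g.contMDiff _)
  have hcoord := hsection.comp y
    ((contMDiffOn_extChartAt_symm (I := 𝓘(ℝ, E)) (n := ∞) q).contMDiffAt
      ((isOpen_extChartAt_target q).mem_nhds hy))
  refine (contMDiffAt_iff_contDiffAt.1 hcoord).congr_of_eventuallyEq ?_
  filter_upwards [(isOpen_extChartAt_target (I := 𝓘(ℝ, E)) q).mem_nhds hy] with z hz
  have hs := (extChartAt 𝓘(ℝ, E) q).map_target hz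
  ext v w
  simp only [Function.comp_apply, hom_trivializationAt_apply]
  refine Eq.trans ?_ (inCoordinates_apply_eq₂ (F₃ := ℝ) (E₃ := Bundle.Trivial M ℝ)
    (by simpa using hs) (by simpa using hs) (by simp)).symm
  rw [← chartSymmDeriv_eq_trivializationAt_symm hs, ← chartSymmDeriv_eq_trivializationAt_symm hs,
    (extChartAt 𝓘(ℝ, E) q).right_inv hz]
  have hid : (trivializationAt ℝ (Bundle.Trivial M ℝ) q).linearMapAt ℝ
      ((extChartAt 𝓘(ℝ, E) q).symm z) = LinearMap.id :=
    Bundle.Trivial.linearMapAt_trivialization ℝ M ℝ _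
  exact (DFunLike.congr_fun hid _).symm

theorem metricForm_transition (hy : y ∈ (extChartAt 𝓘(ℝ, E) q).target)
    (hy' : (extChartAt 𝓘(ℝ, E) q).symm y ∈ (extChartAt 𝓘(ℝ, E) q').source) (a b : E) :
    metricForm g q y a b = metricForm g q' (transition q q' y)
      (fderiv ℝ (transition q q') y a) (fderiv ℝ (transition q q') y b) := by
  have hs := (extChartAt 𝓘(ℝ, E) q).map_target hy
  have hr := (extChartAt 𝓘(ℝ, E) q).right_inv hy
  have hfderiv := fun v => chartDeriv_eq_fderiv_transition hs hy' (chartSymmDeriv q y v)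
  simp only [chartDeriv_chartSymmDeriv hy, hr] at hfderiv
  rw [← hfderiv, ← hfderiv]
  exact (metricForm_chartDeriv g hy' _ _).symm

theorem christoffel_eq (hy : y ∈ (extChartAt 𝓘(ℝ, E) q).target) (a b c : E) :
    christoffel g q y a b c = christoffelForm (metricForm g q) y a b c := by
  have hd := (contDiffAt_metricForm g hy).differentiableAt (by simp)
  simp only [christoffel, coordMetric_eq, christoffelForm_apply, fderiv_bilin_apply hd]

end MetricInCharts

section TripleCharts

variable {E : Type*} [NormedAddCommGroup E] [NormedSpace ℝ E]
  {M : Type*} [TopologicalSpace M] [ChartedSpace E M] [IsManifold 𝓘(ℝ, E) ∞ M]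
  {u₀ u₁ u : TripleBundle E M}

theorem mem_extChartAt_tripleBundle_source :
    u ∈ (extChartAt (tripleModel E) u₀).source ↔
      u.proj ∈ (extChartAt 𝓘(ℝ, E) u₀.proj).source := by
  rw [extChartAt_source, FiberBundle.chartedSpace_chartAt]
  simp only [mfld_simps]
  rw [show (trivializationAt (R3 →L[ℝ] E) (fun p : M => Bundle.Trivial M R3 p →L[ℝ]
    TangentSpace 𝓘(ℝ, E) p) u₀.proj u).1 = u.proj from rfl]
  simp

theorem mdifferentiableAt_extChartAt_tripleBundle
    (hu : u.proj ∈ (extChartAt 𝓘(ℝ, E) u₀.proj).source) :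
    MDifferentiableAt (tripleModel E) 𝓘(ℝ, E × (R3 →L[ℝ] E)) (extChartAt (tripleModel E) u₀) u :=
  mdifferentiableAt_extChartAt (by
    rwa [← extChartAt_source (tripleModel E), mem_extChartAt_tripleBundle_source])

theorem eventually_mem_source (hu : u.proj ∈ (extChartAt 𝓘(ℝ, E) u₀.proj).source) :
    ∀ᶠ w in 𝓝 u, w.proj ∈ (extChartAt 𝓘(ℝ, E) u₀.proj).source := by
  filter_upwards [(isOpen_extChartAt_source (I := tripleModel E) u₀).mem_nhds
    (mem_extChartAt_tripleBundle_source.2 hu)] with w hw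
  exact mem_extChartAt_tripleBundle_source.1 hw

theorem extChartAt_tripleBundle (hu : u.proj ∈ (extChartAt 𝓘(ℝ, E) u₀.proj).source) :
    extChartAt (tripleModel E) u₀ u = (extChartAt 𝓘(ℝ, E) u₀.proj u.proj,
      (chartDeriv E u₀.proj u.proj).comp (u.snd : R3 →L[ℝ] E)) := by
  have h := TangentBundle.continuousLinearMapAt_trivializationAt (I := 𝓘(ℝ, E)) (𝕜 := ℝ)
    (x₀ := u₀.proj) (x := u.proj) (by simpa using hu)
  rw [FiberBundle.extChartAt]
  simp only [PartialEquiv.coe_trans, Function.comp_apply, PartialEquiv.prod_coe,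
    PartialEquiv.refl_coe, id]
  refine Prod.ext rfl ?_
  change (trivializationAt (R3 →L[ℝ] E) _ u₀.proj u).2 = _
  rw [hom_trivializationAt_apply]
  ext v
  have hs : (trivializationAt R3 (Bundle.Trivial M R3) u₀.proj).symmL ℝ u.proj =
      ContinuousLinearMap.id ℝ R3 := Bundle.Trivial.symmL_trivialization ℝ M R3 _
  rw [ContinuousLinearMap.inCoordinates, h, hs]
  rfl

theorem extChartAt_eq_framePush (hu₀ : u.proj ∈ (extChartAt 𝓘(ℝ, E) u₀.proj).source)
    (hu₁ : u.proj ∈ (extChartAt 𝓘(ℝ, E) u₁.proj).source) :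
    extChartAt (tripleModel E) u₁ u =
      framePush (transition u₀.proj u₁.proj) (extChartAt (tripleModel E) u₀ u) := by
  rw [extChartAt_tripleBundle hu₀, extChartAt_tripleBundle hu₁, framePush]
  refine Prod.ext ?_ (ContinuousLinearMap.ext fun a => ?_)
  · rw [transition, (extChartAt 𝓘(ℝ, E) u₀.proj).left_inv hu₀]
  · exact chartDeriv_eq_fderiv_transition hu₀ hu₁ _

/-- The components of a tangent vector at `u` in the preferred chart at `u₀`. -/
def coordVectorAt (u₀ u : TripleBundle E M) (v : TangentSpace (tripleModel E) u) :
    E × (R3 →L[ℝ] E) :=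
  mfderiv (tripleModel E) 𝓘(ℝ, E × (R3 →L[ℝ] E)) (extChartAt (tripleModel E) u₀) u v

theorem coordVectorAt_self (v : TangentSpace (tripleModel E) u) :
    coordVectorAt u u v = coordVector u v := rfl

theorem coordVectorAt_eq_fderiv_framePush
    (hu₀ : u.proj ∈ (extChartAt 𝓘(ℝ, E) u₀.proj).source)
    (hu₁ : u.proj ∈ (extChartAt 𝓘(ℝ, E) u₁.proj).source) (v : TangentSpace (tripleModel E) u) :
    coordVectorAt u₁ u v =
      fderiv ℝ (framePush (transition u₀.proj u₁.proj)) (extChartAt (tripleModel E) u₀ u)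
        (coordVectorAt u₀ u v) := by
  have hτ : ContDiffAt ℝ 2 (transition u₀.proj u₁.proj) (extChartAt (tripleModel E) u₀ u).1 := by
    rw [extChartAt_tripleBundle hu₀]
    exact (contDiffAt_transition ((extChartAt 𝓘(ℝ, E) u₀.proj).map_source hu₀)
      (by rwa [(extChartAt 𝓘(ℝ, E) u₀.proj).left_inv hu₀])).of_le (by norm_cast)
  have hpush := (differentiableAt_framePush hτ).hasFDerivAt.hasMFDerivAt.comp u
    (mdifferentiableAt_extChartAt_tripleBundle hu₀).hasMFDerivAt
  refine DFunLike.congr_fun (hpush.congr_of_eventuallyEq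
    (f₁ := extChartAt (tripleModel E) u₁) ?_).mfderiv v
  filter_upwards [eventually_mem_source hu₀, eventually_mem_source hu₁] with w hw₀ hw₁
  exact extChartAt_eq_framePush hw₀ hw₁

theorem mdifferentiableAt_proj (u : TripleBundle E M) :
    MDifferentiableAt (tripleModel E) 𝓘(ℝ, E) (fun w : TripleBundle E M => w.proj) u :=
  (contMDiffAt_proj (fun p : M => Bundle.Trivial M R3 p →L[ℝ] TangentSpace 𝓘(ℝ, E) p)
    (n := 1)).mdifferentiableAt (by simp)

theorem coordVectorAt_fst (hu : u.proj ∈ (extChartAt 𝓘(ℝ, E) u₀.proj).source)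
    (v : TangentSpace (tripleModel E) u) :
    (coordVectorAt u₀ u v).1 = chartDeriv E u₀.proj u.proj (projDeriv u v) := by
  have hfst : HasMFDerivAt (tripleModel E) 𝓘(ℝ, E)
      (fun w => (extChartAt (tripleModel E) u₀ w).1) u _ :=
    (ContinuousLinearMap.fst ℝ E (R3 →L[ℝ] E)).hasMFDerivAt.comp u
      (mdifferentiableAt_extChartAt_tripleBundle hu).hasMFDerivAt
  have hbase : HasMFDerivAt (tripleModel E) 𝓘(ℝ, E)
      (fun w : TripleBundle E M => extChartAt 𝓘(ℝ, E) u₀.proj w.proj) u _ :=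
    (mdifferentiableAt_extChartAt (I := 𝓘(ℝ, E)) (by simpa using hu)).hasMFDerivAt.comp u
      (mdifferentiableAt_proj u).hasMFDerivAt
  refine DFunLike.congr_fun (hasMFDerivAt_unique hfst (hbase.congr_of_eventuallyEq ?_)) v
  filter_upwards [eventually_mem_source hu] with w hw
  rw [extChartAt_tripleBundle hw]

end TripleCharts

section FormsInCharts

variable {E : Type*} [NormedAddCommGroup E] [NormedSpace ℝ E]
  {M : Type*} [TopologicalSpace M] [ChartedSpace E M] [IsManifold 𝓘(ℝ, E) ∞ M]
  (g : SmoothMetric E M) {u₀ u : TripleBundle E M}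

theorem canonicalForm_eq (hu : u.proj ∈ (extChartAt 𝓘(ℝ, E) u₀.proj).source)
    (v : TangentSpace (tripleModel E) u) (i : Fin 3) :
    canonicalForm g u v i = coordCanonicalForm (metricForm g u₀.proj)
      (extChartAt (tripleModel E) u₀ u) (coordVectorAt u₀ u v) (stdVec i) := by
  rw [coordCanonicalForm, coordVectorAt_fst hu, extChartAt_tripleBundle hu]
  exact (metricForm_chartDeriv g hu _ _).symm

theorem connectionForm_eq_self (v : TangentSpace (tripleModel E) u) (i j : Fin 3) :
    connectionForm g u v i j = coordConnectionForm (metricForm g u.proj)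
      (extChartAt (tripleModel E) u u) (coordVectorAt u u v) (stdVec i) (stdVec j) := by
  simp only [connectionForm, coordMetric_eq, coordConnectionForm, covDerivForm_apply,
    coordVectorAt_self]
  rw [christoffel_eq]
  rw [extChartAt_tripleBundle (mem_extChartAt_source _)]
  exact mem_extChartAt_target _

theorem connectionForm_eq (hu : u.proj ∈ (extChartAt 𝓘(ℝ, E) u₀.proj).source)
    (v : TangentSpace (tripleModel E) u) (i j : Fin 3) :
    connectionForm g u v i j = coordConnectionForm (metricForm g u₀.proj)
      (extChartAt (tripleModel E) u₀ u) (coordVectorAt u₀ u v) (stdVec i) (stdVec j) := by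
  have hp := mem_extChartAt_source (I := 𝓘(ℝ, E)) u.proj
  have ht := mem_extChartAt_target (I := 𝓘(ℝ, E)) u.proj
  have hsymm : (extChartAt 𝓘(ℝ, E) u.proj).symm (extChartAt 𝓘(ℝ, E) u.proj u.proj) ∈
    (extChartAt 𝓘(ℝ, E) u₀.proj).source := by
    rwa [(extChartAt 𝓘(ℝ, E) u.proj).left_inv hp]
  have hy : (extChartAt (tripleModel E) u u).1 = extChartAt 𝓘(ℝ, E) u.proj u.proj := by
    rw [extChartAt_tripleBundle hp]
  rw [connectionForm_eq_self, extChartAt_eq_framePush hp hu,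
    coordVectorAt_eq_fderiv_framePush hp hu, coordConnectionForm_framePush]
  all_goals rw [hy]
  · exact (contDiffAt_transition ht hsymm).of_le (by norm_cast)
  · exact (contDiffAt_metricForm g ht).differentiableAt (by simp)
  · exact (contDiffAt_metricForm g
      ((extChartAt 𝓘(ℝ, E) u₀.proj).map_source hsymm)).differentiableAt (by simp)
  · exact metricForm_symm g _ _
  · filter_upwards [eventually_mem_transition ht hsymm] with z hz
    exact metricForm_transition g hz.1 hz.2

end FormsInCharts

section VelocitiesInCharts

variable {E : Type*} [NormedAddCommGroup E] [NormedSpace ℝ E]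
  {M : Type*} [TopologicalSpace M] [ChartedSpace E M] [IsManifold 𝓘(ℝ, E) ∞ M]
  {P : Type*} [NormedAddCommGroup P] [NormedSpace ℝ P]
  {u₀ : TripleBundle E M} {F : P → TripleBundle E M} {S : Set P} {p : P}

theorem fderivWithin_extChartAt_comp
    (hF : MDifferentiableWithinAt 𝓘(ℝ, P) (tripleModel E) F S p) (hS : UniqueDiffWithinAt ℝ S p)
    (hu : (F p).proj ∈ (extChartAt 𝓘(ℝ, E) u₀.proj).source) (e : P) :
    fderivWithin ℝ (fun q => extChartAt (tripleModel E) u₀ (F q)) S p e =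
      coordVectorAt u₀ (F p) (mfderivWithin 𝓘(ℝ, P) (tripleModel E) F S p e) := by
  rw [← mfderivWithin_eq_fderivWithin]
  exact DFunLike.congr_fun (((mdifferentiableAt_extChartAt_tripleBundle hu).hasMFDerivAt
    |>.comp_hasMFDerivWithinAt p hF.hasMFDerivWithinAt).mfderivWithin
      (uniqueMDiffWithinAt_iff_uniqueDiffWithinAt.2 hS)) e

end VelocitiesInCharts

section CircleAction

variable {E : Type*} [NormedAddCommGroup E] [NormedSpace ℝ E]
  {M : Type*} [TopologicalSpace M] [ChartedSpace E M] [IsManifold 𝓘(ℝ, E) ∞ M]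

/-- The generator `Y` of the circle action, as a linear map of `ℝ³`. -/
def rotationGenerator : R3 →L[ℝ] R3 :=
  LinearMap.toContinuousLinearMap (Matrix.toLin' !![0, 1, 0; -1, 0, 0; 0, 0, 0])

theorem rotationGenerator_stdVec_zero : rotationGenerator (stdVec 0) = -stdVec 1 := by
  ext i
  fin_cases i <;> simp [rotationGenerator, stdVec]

theorem rotationGenerator_stdVec_one : rotationGenerator (stdVec 1) = stdVec 0 := by
  ext i
  fin_cases i <;> simp [rotationGenerator, stdVec]

theorem rotationGenerator_stdVec_two : rotationGenerator (stdVec 2) = 0 := by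
  ext i
  fin_cases i <;> simp [rotationGenerator, stdVec]

theorem hasDerivAt_rotation :
    HasDerivAt (fun s => LinearMap.toContinuousLinearMap (Matrix.toLin' (rotation s)))
      rotationGenerator 0 := by
  let L : (Fin 3 → Fin 3 → ℝ) →L[ℝ] R3 →L[ℝ] R3 := LinearMap.toContinuousLinearMap
    (LinearMap.toContinuousLinearMap.toLinearMap ∘ₗ Matrix.toLin'.toLinearMap ∘ₗ
      (Matrix.ofLinearEquiv ℝ).toLinearMap)
  have hentries : HasDerivAt (fun s i j => rotation s i j)
      (fun i j => !![0, 1, 0; -1, 0, 0; 0, 0, 0] i j) 0 := by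
    have hcos : HasDerivAt (fun s => Real.cos s) 0 0 := by simpa using Real.hasDerivAt_cos 0
    have hsin : HasDerivAt (fun s => Real.sin s) 1 0 := by simpa using Real.hasDerivAt_sin 0
    refine hasDerivAt_pi.2 fun i => hasDerivAt_pi.2 fun j => ?_
    fin_cases i <;> fin_cases j <;>
      simp [rotation, hasDerivAt_const, hcos, hsin, hsin.fun_neg]
  exact L.hasFDerivAt.comp_hasDerivAt 0 hentries

variable (u : TripleBundle E M)

theorem extChartAt_circleFlow (s : ℝ) :
    extChartAt (tripleModel E) u (circleFlow u s) =
      ((extChartAt (tripleModel E) u u).1, (extChartAt (tripleModel E) u u).2.comp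
        (LinearMap.toContinuousLinearMap (Matrix.toLin' (rotation s)))) := by
  have hp := mem_extChartAt_source (I := 𝓘(ℝ, E)) u.proj
  rw [extChartAt_tripleBundle hp, extChartAt_tripleBundle (u := circleFlow u s) hp]
  rfl

theorem hasDerivAt_extChartAt_circleFlow :
    HasDerivAt (fun s => extChartAt (tripleModel E) u (circleFlow u s))
      (0, (extChartAt (tripleModel E) u u).2.comp rotationGenerator) 0 := by
  simp only [extChartAt_circleFlow]
  refine (hasDerivAt_const _ _).prodMk ?_
  simpa using (hasDerivAt_const (0 : ℝ) (extChartAt (tripleModel E) u u).2).clm_comp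
    hasDerivAt_rotation

theorem mdifferentiableAt_circleFlow :
    MDifferentiableAt 𝓘(ℝ, ℝ) (tripleModel E) (circleFlow u) 0 := by
  rw [mdifferentiableAt_totalSpace]
  refine ⟨mdifferentiableAt_const, ?_⟩
  have hfiber : DifferentiableAt ℝ (fun s => (extChartAt (tripleModel E) u (circleFlow u s)).2) 0 :=
    (hasDerivAt_extChartAt_circleFlow u).differentiableAt.snd
  exact hfiber.mdifferentiableAt

theorem coordVectorAt_cast {u₀ u u' : TripleBundle E M} (h : u' = u)
    (v : TangentSpace (tripleModel E) u') : coordVectorAt u₀ u (h ▸ v) = coordVectorAt u₀ u' v := by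
  subst h
  rfl

theorem coordVectorAt_circleField :
    coordVectorAt u u (circleField u) =
      (0, (extChartAt (tripleModel E) u u).2.comp rotationGenerator) := by
  rw [circleField, coordVectorAt_cast, ← mfderivWithin_univ, ← fderivWithin_extChartAt_comp
    (mdifferentiableAt_circleFlow u).mdifferentiableWithinAt uniqueDiffWithinAt_univ
    (mem_extChartAt_source (I := 𝓘(ℝ, E)) u.proj), fderivWithin_univ]
  exact (hasDerivAt_extChartAt_circleFlow u).deriv

theorem canonicalForm_circleField (g : SmoothMetric E M) (i : Fin 3) :
    canonicalForm g u (circleField u) i = 0 := by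
  rw [canonicalForm_eq g (mem_extChartAt_source u.proj), coordVectorAt_circleField,
    coordCanonicalForm, map_zero]

theorem connectionForm_circleField (g : SmoothMetric E M) (i j : Fin 3) :
    connectionForm g u (circleField u) i j = metricForm g u.proj (extChartAt (tripleModel E) u u).1
      ((extChartAt (tripleModel E) u u).2 (stdVec i))
      ((extChartAt (tripleModel E) u u).2 (rotationGenerator (stdVec j))) := by
  rw [connectionForm_eq g (mem_extChartAt_source u.proj), coordVectorAt_circleField,
    coordConnectionForm_vertical _ rfl]
  rfl

end CircleAction

section KropinaIntegrand

variable {E : Type*} [NormedAddCommGroup E] [NormedSpace ℝ E]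
  {M : Type*} [TopologicalSpace M] [ChartedSpace E M] [IsManifold 𝓘(ℝ, E) ∞ M]
  {g : SmoothMetric E M} {u₀ u : TripleBundle E M}

variable (g) in
/-- The bundle of orthonormal frames of `(M, g)` of either orientation. -/
def orthonormalFrames : Set (TripleBundle E M) :=
  {u | ∀ i j, g.inner u.proj (frameVec u i) (frameVec u j) = if i = j then 1 else 0}

theorem isOrthonormalFor_metricForm (hu : u.proj ∈ (extChartAt 𝓘(ℝ, E) u₀.proj).source)
    (hon : u ∈ orthonormalFrames g) :
    IsOrthonormalFor (metricForm g u₀.proj (extChartAt (tripleModel E) u₀ u).1)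
      fun i => (extChartAt (tripleModel E) u₀ u).2 (stdVec i) := fun i j => by
  rw [extChartAt_tripleBundle hu, ← hon i j]
  exact metricForm_chartDeriv g hu _ _

theorem feffermanMetric_circleField (hon : u ∈ orthonormalFrames g)
    (v : TangentSpace (tripleModel E) u) :
    feffermanMetric g u (circleField u) v = canonicalForm g u v 2 := by
  have h := isOrthonormalFor_metricForm (mem_extChartAt_source u.proj) hon
  simp only [IsOrthonormalFor] at h
  simp only [feffermanMetric, canonicalForm_circleField, connectionComp, Fin.sum_univ_three,
    connectionForm_circleField, Matrix.cons_val, rotationGenerator_stdVec_zero,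
    rotationGenerator_stdVec_one, rotationGenerator_stdVec_two, map_zero, map_neg, h]
  simp

variable {a b t : ℝ} {γ : ℝ → TripleBundle E M}

theorem kropinaDenom_eq (hon : γ t ∈ orthonormalFrames g) :
    kropinaDenom g a b γ t = canonicalForm g (γ t) (frameVelocity a b γ t) 2 :=
  feffermanMetric_circleField hon _

theorem kropinaIntegrand_eq (hon : γ t ∈ orthonormalFrames g) :
    kropinaIntegrand g a b γ t = kropinaQuotient
      (canonicalForm g (γ t) (frameVelocity a b γ t))
      (connectionForm g (γ t) (frameVelocity a b γ t)) := by
  rw [kropinaIntegrand, kropinaDenom_eq hon, feffermanMetric, kropinaQuotient]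
  simp only [Fin.sum_univ_three, connectionComp, Matrix.cons_val]
  ring

end KropinaIntegrand

section FamiliesOfFrames

variable {E : Type*} [NormedAddCommGroup E] [NormedSpace ℝ E]
  {M : Type*} [TopologicalSpace M] [ChartedSpace E M] [IsManifold 𝓘(ℝ, E) ∞ M]
  {P : Type*} [NormedAddCommGroup P] [NormedSpace ℝ P]
  {u₀ : TripleBundle E M} {F : P → TripleBundle E M} {S : Set P} {p : P}

theorem contDiffWithinAt_coordCanonicalForm {V : Type*} [NormedAddCommGroup V] [NormedSpace ℝ V]
    {n : ℕ∞ω} {H : E → E →L[ℝ] E →L[ℝ] ℝ} {z v : P → E × (V →L[ℝ] E)}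
    (hH : ContDiffAt ℝ n H (z p).1) (hz : ContDiffWithinAt ℝ n z S p)
    (hv : ContDiffWithinAt ℝ n v S p) (a : V) :
    ContDiffWithinAt ℝ n (fun q => coordCanonicalForm H (z q) (v q) a) S p :=
  ((hH.comp_contDiffWithinAt p hz.fst).clm_apply
    (hz.snd.clm_apply contDiffWithinAt_const)).clm_apply hv.fst

theorem contDiffWithinAt_coordConnectionForm {V : Type*} [NormedAddCommGroup V] [NormedSpace ℝ V]
    {n : ℕ∞ω} {H : E → E →L[ℝ] E →L[ℝ] ℝ} {z v : P → E × (V →L[ℝ] E)}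
    (hH : ContDiffAt ℝ (n + 1) H (z p).1) (hz : ContDiffWithinAt ℝ n z S p)
    (hv : ContDiffWithinAt ℝ n v S p) (a b : V) :
    ContDiffWithinAt ℝ n (fun q => coordConnectionForm H (z q) (v q) a b) S p := by
  have hmetric := (hH.of_le le_self_add).comp_contDiffWithinAt p hz.fst
  have hderiv := (hH.fderiv_right le_rfl).comp_contDiffWithinAt p hz.fst
  have hvec : ∀ c, ContDiffWithinAt ℝ n (fun q => (z q).2 c) S p :=
    fun c => hz.snd.clm_apply contDiffWithinAt_const
  have trilin : ∀ {X Y Z : P → E}, ContDiffWithinAt ℝ n X S p → ContDiffWithinAt ℝ n Y S p →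
      ContDiffWithinAt ℝ n Z S p →
      ContDiffWithinAt ℝ n (fun q => fderiv ℝ H (z q).1 (X q) (Y q) (Z q)) S p :=
    fun hX hY hZ => ((hderiv.clm_apply hX).clm_apply hY).clm_apply hZ
  simp only [coordConnectionForm, covDerivForm_apply, christoffelForm_apply]
  exact ((hmetric.clm_apply (hvec a)).clm_apply (hv.snd.clm_apply contDiffWithinAt_const)).add
    (((trilin hv.fst (hvec b) (hvec a)).add (trilin (hvec b) hv.fst (hvec a))).sub
      (trilin (hvec a) hv.fst (hvec b)) |>.div_const 2)

theorem contDiffWithinAt_extChartAt_comp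
    (hF : ContMDiffWithinAt 𝓘(ℝ, P) (tripleModel E) 2 F S p)
    (hu : (F p).proj ∈ (extChartAt 𝓘(ℝ, E) u₀.proj).source) :
    ContDiffWithinAt ℝ 2 (fun q => extChartAt (tripleModel E) u₀ (F q)) S p := by
  rw [← contMDiffWithinAt_iff_contDiffWithinAt]
  exact (contMDiffAt_extChartAt' (I := tripleModel E) (n := 2) (x := u₀) (by
    rwa [← extChartAt_source (tripleModel E), mem_extChartAt_tripleBundle_source]))
      |>.comp_contMDiffWithinAt p hF

variable (g : SmoothMetric E M)

theorem contDiffAt_metricForm_of_mem_source {u : TripleBundle E M}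
    (hu : u.proj ∈ (extChartAt 𝓘(ℝ, E) u₀.proj).source) :
    ContDiffAt ℝ 2 (metricForm g u₀.proj) (extChartAt (tripleModel E) u₀ u).1 := by
  rw [extChartAt_tripleBundle hu]
  exact (contDiffAt_metricForm g ((extChartAt 𝓘(ℝ, E) u₀.proj).map_source hu)).of_le
    (by norm_cast)

theorem canonicalForm_mfderivWithin_eq
    (hF : MDifferentiableWithinAt 𝓘(ℝ, P) (tripleModel E) F S p) (hS : UniqueDiffWithinAt ℝ S p)
    (hu : (F p).proj ∈ (extChartAt 𝓘(ℝ, E) u₀.proj).source) (e : P) (i : Fin 3) :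
    canonicalForm g (F p) (mfderivWithin 𝓘(ℝ, P) (tripleModel E) F S p e) i =
      coordCanonicalForm (metricForm g u₀.proj) (extChartAt (tripleModel E) u₀ (F p))
        (fderivWithin ℝ (fun q => extChartAt (tripleModel E) u₀ (F q)) S p e) (stdVec i) := by
  rw [fderivWithin_extChartAt_comp hF hS hu, canonicalForm_eq g hu]

theorem connectionForm_mfderivWithin_eq
    (hF : MDifferentiableWithinAt 𝓘(ℝ, P) (tripleModel E) F S p) (hS : UniqueDiffWithinAt ℝ S p)
    (hu : (F p).proj ∈ (extChartAt 𝓘(ℝ, E) u₀.proj).source) (e : P) (i j : Fin 3) :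
    connectionForm g (F p) (mfderivWithin 𝓘(ℝ, P) (tripleModel E) F S p e) i j =
      coordConnectionForm (metricForm g u₀.proj) (extChartAt (tripleModel E) u₀ (F p))
        (fderivWithin ℝ (fun q => extChartAt (tripleModel E) u₀ (F q)) S p e)
        (stdVec i) (stdVec j) := by
  rw [fderivWithin_extChartAt_comp hF hS hu, connectionForm_eq g hu]

theorem contDiffOn_canonicalForm_mfderivWithin
    (hF : ContMDiffOn 𝓘(ℝ, P) (tripleModel E) 2 F S) (hS : UniqueDiffOn ℝ S) (e : P) (i : Fin 3) :
    ContDiffOn ℝ 1 (fun p => canonicalForm g (F p)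
      (mfderivWithin 𝓘(ℝ, P) (tripleModel E) F S p e) i) S := by
  intro p hp
  have hu := mem_extChartAt_source (I := 𝓘(ℝ, E)) (F p).proj
  have hchart := contDiffWithinAt_extChartAt_comp (hF p hp) hu
  refine (contDiffWithinAt_coordCanonicalForm
    (z := fun q => extChartAt (tripleModel E) (F p) (F q))
    ((contDiffAt_metricForm_of_mem_source g hu).of_le one_le_two)
    (hchart.of_le one_le_two)
    ((hchart.fderivWithin_right hS one_add_one_eq_two.le hp).clm_apply
      (contDiffWithinAt_const (c := e)))
    (stdVec i)).congr_of_eventuallyEq_of_mem ?_ hp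
  filter_upwards [(hF.continuousOn p hp).eventually (eventually_mem_source hu),
    self_mem_nhdsWithin] with q hq hqS
  exact canonicalForm_mfderivWithin_eq g (hF.mdifferentiableOn two_ne_zero q hqS) (hS q hqS) hq e i

theorem contDiffOn_connectionForm_mfderivWithin
    (hF : ContMDiffOn 𝓘(ℝ, P) (tripleModel E) 2 F S) (hS : UniqueDiffOn ℝ S) (e : P)
    (i j : Fin 3) :
    ContDiffOn ℝ 1 (fun p => connectionForm g (F p)
      (mfderivWithin 𝓘(ℝ, P) (tripleModel E) F S p e) i j) S := by
  intro p hp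
  have hu := mem_extChartAt_source (I := 𝓘(ℝ, E)) (F p).proj
  have hchart := contDiffWithinAt_extChartAt_comp (hF p hp) hu
  refine (contDiffWithinAt_coordConnectionForm
    (z := fun q => extChartAt (tripleModel E) (F p) (F q))
    ((contDiffAt_metricForm_of_mem_source g hu).of_le one_add_one_eq_two.le)
    (hchart.of_le one_le_two)
    ((hchart.fderivWithin_right hS one_add_one_eq_two.le hp).clm_apply
      (contDiffWithinAt_const (c := e)))
    (stdVec i) (stdVec j)).congr_of_eventuallyEq_of_mem ?_ hp
  filter_upwards [(hF.continuousOn p hp).eventually (eventually_mem_source hu),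
    self_mem_nhdsWithin] with q hq hqS
  exact connectionForm_mfderivWithin_eq g (hF.mdifferentiableOn two_ne_zero q hqS) (hS q hqS) hq
    e i j

end FamiliesOfFrames

section FirstVariation

variable {E : Type*} [NormedAddCommGroup E] [NormedSpace ℝ E]
  {M : Type*} [TopologicalSpace M] [ChartedSpace E M] [IsManifold 𝓘(ℝ, E) ∞ M]

theorem exists_hasDerivAt_kropinaQuotient {g : SmoothMetric E M} {F : ℝ × ℝ → TripleBundle E M}
    {s t f : ℝ} (hE : Module.finrank ℝ E = 3)
    (hF : ContMDiffAt 𝓘(ℝ, ℝ × ℝ) (tripleModel E) 2 F (s, t))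
    (hon : ∀ᶠ p in 𝓝 (s, t), F p ∈ orthonormalFrames g)
    (hvert : ∀ᶠ r in 𝓝 t,
      projDeriv (F (s, r)) (mfderiv 𝓘(ℝ, ℝ × ℝ) (tripleModel E) F (s, r) (1, 0)) = 0)
    (hf : f ≠ 0)
    (hlift : projDeriv (F (s, t)) (mfderiv 𝓘(ℝ, ℝ × ℝ) (tripleModel E) F (s, t) (0, 1)) =
      f • frameVec (F (s, t)) 2) :
    ∃ c, HasDerivAt (fun r => connectionForm g (F (s, r))
        (mfderiv 𝓘(ℝ, ℝ × ℝ) (tripleModel E) F (s, r) (1, 0)) 0 1) c t ∧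
      HasDerivAt (fun ε => kropinaQuotient
        (canonicalForm g (F (ε, t)) (mfderiv 𝓘(ℝ, ℝ × ℝ) (tripleModel E) F (ε, t) (0, 1)))
        (connectionForm g (F (ε, t)) (mfderiv 𝓘(ℝ, ℝ × ℝ) (tripleModel E) F (ε, t) (0, 1))))
        (2 * c) s := by
  have hu := mem_extChartAt_source (I := 𝓘(ℝ, E)) (F (s, t)).proj
  have hdiff : ∀ᶠ p in 𝓝 (s, t), MDifferentiableAt 𝓘(ℝ, ℝ × ℝ) (tripleModel E) F p :=
    ((contMDiffAt_iff_contMDiffAt_nhds (by simp)).1 hF).mono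
      fun p hp => hp.mdifferentiableAt two_ne_zero
  have hsource := hF.continuousAt.eventually (eventually_mem_source hu)
  have hcoord : ∀ᶠ p in 𝓝 (s, t), ∀ e,
      fderiv ℝ (fun q => extChartAt (tripleModel E) (F (s, t)) (F q)) p e =
        coordVectorAt (F (s, t)) (F p) (mfderiv 𝓘(ℝ, ℝ × ℝ) (tripleModel E) F p e) := by
    filter_upwards [hdiff, hsource] with p hp hup e
    simpa only [mfderivWithin_univ, fderivWithin_univ] using
      fderivWithin_extChartAt_comp hp.mdifferentiableWithinAt uniqueDiffWithinAt_univ hup e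
  have hsnd := (Continuous.prodMk_right s).continuousAt (x := t)
  have hfst := (Continuous.prodMk_left t).continuousAt (x := s)
  obtain ⟨c, hV, hL⟩ := exists_hasDerivAt_kropinaQuotient_coord (e := stdVec) (s := s) (t := t)
    (Ψ := fun q => extChartAt (tripleModel E) (F (s, t)) (F q)) hE
    (metricForm_symm g (F (s, t)).proj) (contDiffAt_metricForm_of_mem_source g hu)
    (contDiffWithinAt_univ.1 (contDiffWithinAt_extChartAt_comp hF.contMDiffWithinAt hu))
    (by
      filter_upwards [hsnd.eventually hsource, hsnd.eventually hcoord, hvert] with r hur hr hvr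
      rw [hr, coordVectorAt_fst hur, hvr]
      exact map_zero (chartDeriv E _ _))
    (by filter_upwards [hsource, hon] with p hup hp using isOrthonormalFor_metricForm hup hp) hf
    (by
      rw [hcoord.self_of_nhds, coordVectorAt_fst hu, hlift, extChartAt_tripleBundle hu]
      exact map_smul (chartDeriv E _ _) f _)
  refine ⟨c, hV.congr_of_eventuallyEq ?_, hL.congr_of_eventuallyEq ?_⟩
  · filter_upwards [hsnd.eventually hsource, hsnd.eventually hcoord] with r hur hr
    rw [connectionForm_eq g hur, hr]
  · filter_upwards [hfst.eventually hsource, hfst.eventually hcoord] with ε huε hε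
    simp only [hε, ← canonicalForm_eq g huε, ← connectionForm_eq g huε]

end FirstVariation

section Lift

variable {E : Type*} [NormedAddCommGroup E] [NormedSpace ℝ E]
  {M : Type*} [TopologicalSpace M] [ChartedSpace E M] [IsManifold 𝓘(ℝ, E) ∞ M]

theorem canonicalForm_of_projDeriv_eq_smul {g : SmoothMetric E M} {u : TripleBundle E M}
    (hu : u ∈ orthonormalFrames g) {v : TangentSpace (tripleModel E) u} {f : ℝ} {i : Fin 3}
    (hv : projDeriv u v = f • frameVec u i) : canonicalForm g u v i = f := by
  rw [canonicalForm, hv, map_smul, hu i i]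
  simp

theorem connectionForm_zero (g : SmoothMetric E M) (u : TripleBundle E M) (i j : Fin 3) :
    connectionForm g u 0 i j = 0 := by
  rw [connectionForm_eq g (mem_extChartAt_source (I := 𝓘(ℝ, E)) u.proj)]
  have hzero : coordVectorAt u u 0 = 0 :=
    map_zero (mfderiv (tripleModel E) 𝓘(ℝ, E × (R3 →L[ℝ] E)) (extChartAt (tripleModel E) u) u)
  simp [hzero, coordConnectionForm, covDerivForm_apply, christoffelForm_apply]

end Lift

section Variations

variable {E : Type*} [NormedAddCommGroup E] [NormedSpace ℝ E]
  {M : Type*} [TopologicalSpace M] [ChartedSpace E M] [IsManifold 𝓘(ℝ, E) ∞ M]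
  {a b : ℝ} {J : Set ℝ} {Γ : ℝ → ℝ → TripleBundle E M}

theorem frameVelocity_eq_mfderivWithin {p : ℝ × ℝ} (hab : a < b) (hp : p ∈ J ×ˢ Icc a b)
    (hΓ : MDifferentiableWithinAt 𝓘(ℝ, ℝ × ℝ) (tripleModel E) (fun q : ℝ × ℝ => Γ q.1 q.2)
      (J ×ˢ Icc a b) p) :
    frameVelocity a b (Γ p.1) p.2 =
      mfderivWithin 𝓘(ℝ, ℝ × ℝ) (tripleModel E) (fun q : ℝ × ℝ => Γ q.1 q.2) (J ×ˢ Icc a b) p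
        ((0, 1) : ℝ × ℝ) := by
  have hslice : HasMFDerivWithinAt 𝓘(ℝ, ℝ) 𝓘(ℝ, ℝ × ℝ) (fun r : ℝ => (p.1, r)) (Icc a b) p.2
      (ContinuousLinearMap.inr ℝ ℝ ℝ) :=
    hasMFDerivWithinAt_iff_hasFDerivWithinAt.2
      (hasFDerivAt_prodMk_right p.1 p.2).hasFDerivWithinAt
  have h := (hΓ.hasMFDerivWithinAt.comp p.2 hslice fun r hr => mk_mem_prod hp.1 hr).mfderivWithin
    (uniqueMDiffOn_iff_uniqueDiffOn.2 (uniqueDiffOn_Icc hab) p.2 hp.2)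
  exact DFunLike.congr_fun h (1 : ℝ)

theorem variationField_eq_mfderivWithin {t : ℝ} (hJ : J ∈ 𝓝 0) (ht : t ∈ Icc a b)
    (hΓ : MDifferentiableWithinAt 𝓘(ℝ, ℝ × ℝ) (tripleModel E) (fun q : ℝ × ℝ => Γ q.1 q.2)
      (J ×ˢ Icc a b) (0, t)) :
    variationField Γ t =
      mfderivWithin 𝓘(ℝ, ℝ × ℝ) (tripleModel E) (fun q : ℝ × ℝ => Γ q.1 q.2) (J ×ˢ Icc a b) (0, t)
        ((1, 0) : ℝ × ℝ) := by
  have hslice : HasMFDerivWithinAt 𝓘(ℝ, ℝ) 𝓘(ℝ, ℝ × ℝ) (fun ε : ℝ => (ε, t)) J 0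
      (ContinuousLinearMap.inl ℝ ℝ ℝ) :=
    hasMFDerivWithinAt_iff_hasFDerivWithinAt.2 (hasFDerivAt_prodMk_left 0 t).hasFDerivWithinAt
  have h := ((hΓ.hasMFDerivWithinAt.comp (0 : ℝ) hslice fun ε hε => mk_mem_prod hε ht).hasMFDerivAt
    hJ).mfderiv
  exact DFunLike.congr_fun h (1 : ℝ)

theorem variationField_eq_zero_of_eventually_eq {u : TripleBundle E M} {t : ℝ}
    (h : ∀ᶠ ε in 𝓝 0, Γ ε t = u) : variationField Γ t = 0 := by
  have hconst := EventuallyEq.mfderiv_eq (I := 𝓘(ℝ, ℝ)) (I' := tripleModel E)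
    (f₁ := fun ε => Γ ε t) (f := fun _ => u) h
  rw [mfderiv_const] at hconst
  exact DFunLike.congr_fun hconst (1 : ℝ)

variable (g : SmoothMetric E M)

theorem contDiffOn_canonicalForm_frameVelocity (hab : a < b) (hJ : IsOpen J)
    (hΓ : ContMDiffOn 𝓘(ℝ, ℝ × ℝ) (tripleModel E) 2 (fun q : ℝ × ℝ => Γ q.1 q.2) (J ×ˢ Icc a b))
    (i : Fin 3) :
    ContDiffOn ℝ 1 (fun p : ℝ × ℝ => canonicalForm g (Γ p.1 p.2) (frameVelocity a b (Γ p.1) p.2) i)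
      (J ×ˢ Icc a b) :=
  (contDiffOn_canonicalForm_mfderivWithin g hΓ (hJ.uniqueDiffOn.prod (uniqueDiffOn_Icc hab)) (0, 1)
    i).congr fun p hp => by
      rw [frameVelocity_eq_mfderivWithin hab hp (hΓ.mdifferentiableOn two_ne_zero p hp)]

theorem contDiffOn_connectionForm_frameVelocity (hab : a < b) (hJ : IsOpen J)
    (hΓ : ContMDiffOn 𝓘(ℝ, ℝ × ℝ) (tripleModel E) 2 (fun q : ℝ × ℝ => Γ q.1 q.2) (J ×ˢ Icc a b))
    (i j : Fin 3) :
    ContDiffOn ℝ 1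
      (fun p : ℝ × ℝ => connectionForm g (Γ p.1 p.2) (frameVelocity a b (Γ p.1) p.2) i j)
      (J ×ˢ Icc a b) :=
  (contDiffOn_connectionForm_mfderivWithin g hΓ (hJ.uniqueDiffOn.prod (uniqueDiffOn_Icc hab)) (0, 1)
    i j).congr fun p hp => by
      rw [frameVelocity_eq_mfderivWithin hab hp (hΓ.mdifferentiableOn two_ne_zero p hp)]

theorem continuousOn_connectionForm_variationField (hab : a < b) (hJ : IsOpen J) (h0 : 0 ∈ J)
    (hΓ : ContMDiffOn 𝓘(ℝ, ℝ × ℝ) (tripleModel E) 2 (fun q : ℝ × ℝ => Γ q.1 q.2) (J ×ˢ Icc a b))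
    (i j : Fin 3) :
    ContinuousOn (fun t => connectionForm g (Γ 0 t) (variationField Γ t) i j) (Icc a b) := by
  refine ((contDiffOn_connectionForm_mfderivWithin g hΓ
    (hJ.uniqueDiffOn.prod (uniqueDiffOn_Icc hab)) (1, 0) i j).continuousOn.comp
    (f := fun t => (0, t)) (by fun_prop) fun t ht => ⟨h0, ht⟩).congr fun t ht => ?_
  simp only [variationField_eq_mfderivWithin (hJ.mem_nhds h0) ht
    (hΓ.mdifferentiableOn two_ne_zero (0, t) ⟨h0, ht⟩)]
  rfl

variable {g}

theorem contDiffOn_kropinaDenom (hab : a < b) (hJ : IsOpen J)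
    (hΓ : ContMDiffOn 𝓘(ℝ, ℝ × ℝ) (tripleModel E) 2 (fun q : ℝ × ℝ => Γ q.1 q.2) (J ×ˢ Icc a b))
    (hon : ∀ ε ∈ J, ∀ t ∈ Icc a b, Γ ε t ∈ orthonormalFrames g) :
    ContDiffOn ℝ 1 (fun p : ℝ × ℝ => kropinaDenom g a b (Γ p.1) p.2) (J ×ˢ Icc a b) :=
  (contDiffOn_canonicalForm_frameVelocity g hab hJ hΓ 2).congr fun p hp =>
    kropinaDenom_eq (hon p.1 hp.1 p.2 hp.2)

theorem contDiffOn_kropinaIntegrand (hab : a < b) (hJ : IsOpen J)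
    (hΓ : ContMDiffOn 𝓘(ℝ, ℝ × ℝ) (tripleModel E) 2 (fun q : ℝ × ℝ => Γ q.1 q.2) (J ×ˢ Icc a b))
    (hon : ∀ ε ∈ J, ∀ t ∈ Icc a b, Γ ε t ∈ orthonormalFrames g)
    (hne : ∀ ε ∈ J, ∀ t ∈ Icc a b, kropinaDenom g a b (Γ ε) t ≠ 0) :
    ContDiffOn ℝ 1 (fun p : ℝ × ℝ => kropinaIntegrand g a b (Γ p.1) p.2) (J ×ˢ Icc a b) := by
  have hφ := contDiffOn_canonicalForm_frameVelocity g hab hJ hΓ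
  have hθ := contDiffOn_connectionForm_frameVelocity g hab hJ hΓ
  refine ContDiffOn.div ?_ (contDiffOn_kropinaDenom hab hJ hΓ hon) fun p hp =>
    hne p.1 hp.1 p.2 hp.2
  simp only [feffermanMetric, connectionComp, Fin.sum_univ_three, Matrix.cons_val]
  exact ((((hφ 0).mul (hθ 1 2)).add ((hφ 0).mul (hθ 1 2))).add
    (((hφ 1).mul (hθ 2 0)).add ((hφ 1).mul (hθ 2 0)))).add
    (((hφ 2).mul (hθ 0 1)).add ((hφ 2).mul (hθ 0 1)))

theorem eventually_kropinaDenom_ne_zero (hab : a < b) (hJ : IsOpen J) (h0 : 0 ∈ J)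
    (hΓ : ContMDiffOn 𝓘(ℝ, ℝ × ℝ) (tripleModel E) 2 (fun q : ℝ × ℝ => Γ q.1 q.2) (J ×ˢ Icc a b))
    (hon : ∀ ε ∈ J, ∀ t ∈ Icc a b, Γ ε t ∈ orthonormalFrames g)
    (hne : ∀ t ∈ Icc a b, kropinaDenom g a b (Γ 0) t ≠ 0) :
    ∀ᶠ ε in 𝓝 (0 : ℝ), ∀ t ∈ Icc a b, kropinaDenom g a b (Γ ε) t ≠ 0 := by
  suffices h : ∀ᶠ ε in 𝓝 (0 : ℝ), ∀ t ∈ Icc a b, t ∈ Icc a b → kropinaDenom g a b (Γ ε) t ≠ 0 from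
    h.mono fun ε hε t ht => hε t ht ht
  refine isCompact_Icc.eventually_forall_of_forall_eventually fun t ht => ?_
  have hne' := ((contDiffOn_kropinaDenom hab hJ hΓ hon).continuousOn (0, t)
    ⟨h0, ht⟩).eventually_ne (hne t ht)
  filter_upwards [eventually_nhdsWithin_iff.1 hne',
    continuousAt_fst.eventually (hJ.mem_nhds h0)] with p hp hpJ hpI
  exact hp ⟨hpJ, hpI⟩

theorem exists_hasDerivAt_kropinaIntegrand {t f : ℝ} (hE : Module.finrank ℝ E = 3) (hJ : IsOpen J)
    (h0 : 0 ∈ J) (ht : t ∈ Ioo a b)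
    (hΓ : ContMDiffOn 𝓘(ℝ, ℝ × ℝ) (tripleModel E) 2 (fun q : ℝ × ℝ => Γ q.1 q.2) (J ×ˢ Icc a b))
    (hon : ∀ ε ∈ J, ∀ t ∈ Icc a b, Γ ε t ∈ orthonormalFrames g)
    (hvert : ∀ t ∈ Icc a b, projDeriv (Γ 0 t) (variationField Γ t) = 0) (hf : f ≠ 0)
    (hlift : projDeriv (Γ 0 t) (frameVelocity a b (Γ 0) t) = f • frameVec (Γ 0 t) 2) :
    ∃ c, HasDerivAt (fun r => connectionForm g (Γ 0 r) (variationField Γ r) 0 1) c t ∧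
      HasDerivAt (fun ε => kropinaIntegrand g a b (Γ ε) t) (2 * c) 0 := by
  have hab : a < b := ht.1.trans ht.2
  have hIoo : ∀ᶠ r in 𝓝 t, r ∈ Ioo a b := isOpen_Ioo.mem_nhds ht
  have hnhds : ∀ ε ∈ J, ∀ r ∈ Ioo a b, J ×ˢ Icc a b ∈ 𝓝 (ε, r) := fun ε hε r hr =>
    prod_mem_nhds (hJ.mem_nhds hε) (Icc_mem_nhds hr.1 hr.2)
  have hvar : ∀ r ∈ Ioo a b, variationField Γ r =
      mfderiv 𝓘(ℝ, ℝ × ℝ) (tripleModel E) (fun q : ℝ × ℝ => Γ q.1 q.2) (0, r)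
        ((1, 0) : ℝ × ℝ) := fun r hr => by
    rw [variationField_eq_mfderivWithin (hJ.mem_nhds h0) (Ioo_subset_Icc_self hr)
      (hΓ.mdifferentiableOn two_ne_zero (0, r) ⟨h0, Ioo_subset_Icc_self hr⟩),
      mfderivWithin_of_mem_nhds (hnhds 0 h0 r hr)]
  have hvel : ∀ ε ∈ J, frameVelocity a b (Γ ε) t =
      mfderiv 𝓘(ℝ, ℝ × ℝ) (tripleModel E) (fun q : ℝ × ℝ => Γ q.1 q.2) (ε, t)
        ((0, 1) : ℝ × ℝ) := fun ε hε => by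
    have hp : (ε, t) ∈ J ×ˢ Icc a b := ⟨hε, Ioo_subset_Icc_self ht⟩
    rw [← mfderivWithin_of_mem_nhds (hnhds ε hε t ht)]
    exact frameVelocity_eq_mfderivWithin hab hp (hΓ.mdifferentiableOn two_ne_zero (ε, t) hp)
  obtain ⟨c, hV, hL⟩ := exists_hasDerivAt_kropinaQuotient (g := g) (f := f) (s := 0) (t := t)
    (F := fun q : ℝ × ℝ => Γ q.1 q.2) hE (hΓ.contMDiffAt (hnhds 0 h0 t ht))
    (by filter_upwards [hnhds 0 h0 t ht] with p hp using hon p.1 hp.1 p.2 hp.2)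
    (by
      filter_upwards [hIoo] with r hr
      rw [← hvar r hr]
      exact hvert r (Ioo_subset_Icc_self hr))
    hf (by rw [← hvel 0 h0]; exact hlift)
  refine ⟨c, hV.congr_of_eventuallyEq ?_, hL.congr_of_eventuallyEq ?_⟩
  · filter_upwards [hIoo] with r hr
    rw [hvar r hr]
  · filter_upwards [hJ.mem_nhds h0] with ε hε
    rw [kropinaIntegrand_eq (hon ε hε t (Ioo_subset_Icc_self ht)), hvel ε hε]

end Variations

section TangentLift

variable {E : Type*} [NormedAddCommGroup E] [NormedSpace ℝ E]
  {M : Type*} [TopologicalSpace M] [ChartedSpace E M] [IsManifold 𝓘(ℝ, E) ∞ M]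
  {a b : ℝ} {x : ℝ → M} {γ : ℝ → TripleBundle E M}

/-- The vector part of a tangent vector, as an element of the model space. An equality of points of
the tangent bundle cannot be projected to the tangent spaces, which are different types. -/
def vectorPart (v : TangentBundle 𝓘(ℝ, E) M) : E := v.snd

theorem projDeriv_frameVelocity (hab : a < b)
    (hγ : MDifferentiableOn 𝓘(ℝ, ℝ) (tripleModel E) γ (Icc a b))
    (hγx : ∀ t ∈ Icc a b, (γ t).proj = x t) {t : ℝ} (ht : t ∈ Icc a b) :
    (projDeriv (γ t) (frameVelocity a b γ t) : E) = baseVelocity E a b x t := by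
  have hcomp := mfderiv_comp_mfderivWithin t (mdifferentiableAt_proj (γ t)) (hγ t ht)
    (uniqueMDiffOn_iff_uniqueDiffOn.2 (uniqueDiffOn_Icc hab) t ht)
  have hbase : mfderivWithin 𝓘(ℝ, ℝ) 𝓘(ℝ, E) ((fun w : TripleBundle E M => w.proj) ∘ γ) (Icc a b) t
      = mfderivWithin 𝓘(ℝ, ℝ) 𝓘(ℝ, E) x (Icc a b) t :=
    mfderivWithin_congr (fun s hs => hγx s hs) (hγx t ht)
  exact DFunLike.congr_fun (hcomp.symm.trans hbase) (1 : ℝ)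

theorem exists_projDeriv_frameVelocity_eq {g : SmoothMetric E M} (hab : a < b)
    (hx : IsRegularCurve E a b x) (hγ : MDifferentiableOn 𝓘(ℝ, ℝ) (tripleModel E) γ (Icc a b))
    (hγx : ∀ t ∈ Icc a b, sphereProj (γ t) = tangentLift g a b x t) {t : ℝ} (ht : t ∈ Icc a b) :
    ∃ f : ℝ, f ≠ 0 ∧ projDeriv (γ t) (frameVelocity a b γ t) = f • frameVec (γ t) 2 := by
  set r := √(g.inner (x t) (baseVelocity E a b x t) (baseVelocity E a b x t))
  have hr : r ≠ 0 := (Real.sqrt_pos.2 (g.pos (x t) _ (hx.2 t ht))).ne'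
  have hvec : (frameVec (γ t) 2 : E) = r⁻¹ • (baseVelocity E a b x t : E) :=
    congrArg vectorPart (hγx t ht)
  have hvel := projDeriv_frameVelocity hab hγ
    (fun s hs => congrArg (TotalSpace.proj (F := E)) (hγx s hs)) ht
  refine ⟨r, hr, hvel.trans ?_⟩
  exact ((congrArg (r • ·) hvec).trans (smul_inv_smul₀ hr _)).symm

end TangentLift

end FeffermanFrame

end

open FeffermanFrame in
theorem proposition5p6_general {E : Type*} [NormedAddCommGroup E] [NormedSpace ℝ E]
    (hE : Module.finrank ℝ E = 3)
    {M : Type*} [TopologicalSpace M] [ChartedSpace E M] [IsManifold 𝓘(ℝ, E) ∞ M]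
    (g : SmoothMetric E M) (a b : ℝ) (hab : a < b)
    (J : Set ℝ) (hJ : IsOpen J) (h0 : 0 ∈ J) (Γ : ℝ → ℝ → TripleBundle E M)
    (hΓ : ContMDiffOn 𝓘(ℝ, ℝ × ℝ) (tripleModel E) 2 (fun q : ℝ × ℝ => Γ q.1 q.2) (J ×ˢ Icc a b))
    (hon : ∀ ε ∈ J, ∀ t ∈ Icc a b, Γ ε t ∈ orthonormalFrames g)
    (hlift : ∀ t ∈ Icc a b, ∃ f : ℝ, f ≠ 0 ∧
      projDeriv (Γ 0 t) (frameVelocity a b (Γ 0) t) = f • frameVec (Γ 0 t) 2)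
    (hvert : ∀ t ∈ Icc a b, projDeriv (Γ 0 t) (variationField Γ t) = 0) :
    (∀ᶠ ε in 𝓝 (0 : ℝ), (∀ t ∈ Icc a b, kropinaDenom g a b (Γ ε) t ≠ 0) ∧
      IntervalIntegrable (kropinaIntegrand g a b (Γ ε)) volume a b) ∧
    HasDerivAt (fun ε : ℝ => ∫ t in a..b, kropinaIntegrand g a b (Γ ε) t)
      (2 * connectionForm g (Γ 0 b) (variationField Γ b) 0 1 -
        2 * connectionForm g (Γ 0 a) (variationField Γ a) 0 1) 0 := by
  have hne : ∀ t ∈ Icc a b, kropinaDenom g a b (Γ 0) t ≠ 0 := fun t ht => by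
    obtain ⟨f, hf, hvel⟩ := hlift t ht
    rwa [kropinaDenom_eq (hon 0 h0 t ht), canonicalForm_of_projDeriv_eq_smul (hon 0 h0 t ht) hvel]
  obtain ⟨U, hU, hUo, hU0⟩ := eventually_nhds_iff.1 <|
    (eventually_kropinaDenom_ne_zero hab hJ h0 hΓ hon hne).and (hJ.mem_nhds h0)
  have hL := contDiffOn_kropinaIntegrand hab hUo
    (hΓ.mono (prod_mono_left fun ε hε => (hU ε hε).2)) (fun ε hε => hon ε (hU ε hε).2)
    fun ε hε => (hU ε hε).1
  refine ⟨?_, hasDerivAt_integral_of_variation_eq_deriv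
    (v := fun t => 2 * connectionForm g (Γ 0 t) (variationField Γ t) 0 1) hab (hUo.mem_nhds hU0) hL
    ((continuousOn_connectionForm_variationField g hab hJ h0 hΓ 0 1).const_smul (2 : ℝ))
    fun t ht => ?_⟩
  · filter_upwards [hUo.mem_nhds hU0] with ε hε
    exact ⟨(hU ε hε).1, ContinuousOn.intervalIntegrable_of_Icc hab.le
      (hL.continuousOn.comp (f := fun t => (ε, t)) (by fun_prop) fun t ht => ⟨hε, ht⟩)⟩
  · obtain ⟨f, hf, hvel⟩ := hlift t (Ioo_subset_Icc_self ht)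
    obtain ⟨c, hV, hQ⟩ := exists_hasDerivAt_kropinaIntegrand hE hJ h0 ht hΓ hon hvert hf hvel
    exact ⟨2 * c, hV.const_mul 2, hQ⟩

open FeffermanFrame in
theorem proposition5p6 {E : Type*} [NormedAddCommGroup E] [NormedSpace ℝ E]
    (hE : Module.finrank ℝ E = 3)
    {M : Type*} [TopologicalSpace M] [T2Space M] [SecondCountableTopology M]
    [ChartedSpace E M] [IsManifold 𝓘(ℝ, E) ∞ M]
    (g : SmoothMetric E M) (o : ManifoldOrientation E M)
    (a b : ℝ) (hab : a < b)
    (x : ℝ → M) (hx : IsRegularCurve E a b x)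
    (γ : ℝ → TripleBundle E M)
    (hγ : ContMDiffOn 𝓘(ℝ, ℝ) (tripleModel E) ∞ γ (Icc a b))
    (hγP : ∀ t ∈ Icc a b, γ t ∈ frameBundle g o)
    (hγx : ∀ t ∈ Icc a b, sphereProj (γ t) = tangentLift g a b x t)
    (δ : ℝ) (hδ : 0 < δ) (Γ : ℝ → ℝ → TripleBundle E M)
    (hΓ : IsVariation g o a b δ γ Γ)
    (hvert : ∀ t ∈ Icc a b, projDeriv (Γ 0 t) (variationField Γ t) = 0) :
    (∀ᶠ ε in 𝓝 (0 : ℝ), (∀ t ∈ Icc a b, kropinaDenom g a b (Γ ε) t ≠ 0) ∧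
      IntervalIntegrable (kropinaIntegrand g a b (Γ ε)) volume a b) ∧
    HasDerivAt (fun ε : ℝ => ∫ t in a..b, kropinaIntegrand g a b (Γ ε) t) 0 0 := by
  have hJ : Ioo (-δ) δ ∈ 𝓝 (0 : ℝ) := Ioo_mem_nhds (neg_lt_zero.2 hδ) hδ
  have hlift := fun t (ht : t ∈ Icc a b) => exists_projDeriv_frameVelocity_eq (γ := Γ 0) hab hx
    ((hγ.congr hΓ.zero).mdifferentiableOn (by simp))
    (fun s hs => (congrArg sphereProj (hΓ.zero s hs)).trans (hγx s hs)) ht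
  have hleft : variationField Γ a = 0 :=
    variationField_eq_zero_of_eventually_eq (eventually_of_mem hJ hΓ.left)
  have hright : variationField Γ b = 0 :=
    variationField_eq_zero_of_eventually_eq (eventually_of_mem hJ hΓ.right)
  simpa only [hleft, hright, connectionForm_zero, sub_self] using
    proposition5p6_general hE g a b hab _ isOpen_Ioo (mem_of_mem_nhds hJ) Γ
      (hΓ.smooth.of_le (by norm_cast)) (fun ε hε t ht => (hΓ.mem ε hε t ht).1) hlift hvert
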